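/- For a complex Hilbert space $\mathcal W$ let $\Gamma_{\rm a}(\mathcal W)=\bigoplus_{n\ge 0}\Gamma_{\rm a}^n(\mathcal W)$ be the fermionic Fock space, $\Gamma_{\rm a}^n(\mathcal W)$ being the antisymmetric part of the $n$-fold Hilbert space tensor power, with orthogonal projection $\Theta_{\rm a}$ onto $\Gamma_{\rm a}(\mathcal W)$, and write $\Psi\otimes_{\rm a}\Phi=\Theta_{\rm a}(\Psi\otimes\Phi)$. Let $a^*(w)$, $w\in\mathcal W$, be the creation operators, $a^*(w)\Psi=\sqrt{n+1}\,w\otimes_{\rm a}\Psi$ for $\Psi\in\Gamma_{\rm a}^n(\mathcal W)$, let $a(w)=a^*(w)^*$ and $\phi(w)=a^*(w)+a(w)$. Let $N$ be the number operator and $\Lambda=(-1)^{N(N-1)/2}$. For a real subspace $\mathcal V\subset\mathcal W$ let $M(\mathcal V)=\{\phi(v):v\in\mathcal V\}''\subset B(\Gamma_{\rm a}(\mathcal W))$, where $'$ denotes the commutant. Let $\mathcal W_1,\mathcal W_2$ be complex Hilbert spaces, $\mathcal W=\mathcal W_1\oplus\mathcal W_2$ with embeddings $j_i:\mathcal W_i\to\mathcal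 W$, and let $N_i$, $\Lambda_i$ be the above operators on $\Gamma_{\rm a}(\mathcal W_i)$ and $N$, $\Lambda$ those on $\Gamma_{\rm a}(\mathcal W)$. Let $U:\Gamma_{\rm a}(\mathcal W_1)\otimes\Gamma_{\rm a}(\mathcal W_2)\to\Gamma_{\rm a}(\mathcal W)$ be the unitary operator with $$U(\Psi_1\otimes\Psi_2)=\sqrt{\tfrac{(n+m)!}{n!\,m!}}\;(\Gamma(j_1)\Psi_1)\otimes_{\rm a}(\Gamma(j_2)\Psi_2),\qquad \Psi_1\in\Gamma_{\rm a}^n(\mathcal W_1),\ \Psi_2\in\Gamma_{\rm a}^m(\mathcal W_2),$$ where $\Gamma(j_i)$ acts as $j_i^{\otimes n}$ on $\Gamma_{\rm a}^n(\mathcal W_i)$. For sets of operators write $\mathcal A\simeq\mathcal B$ if $\mathcal A=U\mathcal B U^*$. Let $(-1)^{N_1\otimes N_2}$ be the operator that multiplies $\Psi_1\otimes\Psi_2$ as above by $(-1)^{nm}$. The tensor product of two von Neumann algebras is the von Neumann algebra generated by the operators $A\otimes B$ with $A$ in the first and $B$ in the second; for an algebra $\mathcal M$ put $\mathcal M\otimes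 1=\{A\otimes 1:A\in\mathcal M\}$ and $1\otimes\mathcal M=\{1\otimes A:A\in\mathcal M\}$. **Theorem.** Let $\mathcal V_i$ be a closed real subspace of $\mathcal W_i$, $i=1,2$. Then $$M(\mathcal V_1\oplus\mathcal V_2)\simeq\Bigl(M(\mathcal V_1)\otimes 1+(-1)^{N_1\otimes N_2}\,\bigl(1\otimes M(\mathcal V_2)\bigr)\,(-1)^{N_1\otimes N_2}\Bigr)'',$$ $$M(\mathcal V_1\oplus\{0\})\simeq M(\mathcal V_1)\otimes 1,\qquad M(\mathcal W_1\oplus\mathcal V_2)\simeq B(\Gamma_{\rm a}(\mathcal W_1))\otimes M(\mathcal V_2),$$ $$\Lambda M(\mathcal V_1\oplus\mathcal W_2)\Lambda\simeq\Lambda_1M(\mathcal V_1)\Lambda_1\otimes B(\Gamma_{\rm a}(\mathcal W_2)),\qquad \Lambda M(\{0\}\oplus\mathcal V_2)\Lambda\simeq 1\otimes\Lambda_2M(\mathcal V_2)\Lambda_2 .$$ -/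

import Mathlib

open UniformSpace
open scoped TensorProduct InnerProductSpace Pointwise

namespace FermiFock

section FiniteParticle

variable {Z : Type*} [NormedAddCommGroup Z] [InnerProductSpace ℂ Z]

/-- Contraction `(w|⌋` with the functional `(w| · )` on the exterior algebra. -/
noncomputable def contr (w : Z) : ExteriorAlgebra ℂ Z →ₗ[ℂ] ExteriorAlgebra ℂ Z :=
  CliffordAlgebra.contractLeft (innerₛₗ ℂ w)

theorem contr_one (w : Z) : contr w 1 = 0 :=
  CliffordAlgebra.contractLeft_one (Q := (0 : QuadraticForm ℂ Z)) _

theorem contr_ι_mul (w z : Z) (Ψ : ExteriorAlgebra ℂ Z) :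
    contr w (ExteriorAlgebra.ι ℂ z * Ψ) =
      ⟪w, z⟫_ℂ • Ψ - ExteriorAlgebra.ι ℂ z * contr w Ψ :=
  CliffordAlgebra.contractLeft_ι_mul _ _ _

theorem ext_induction {P : ExteriorAlgebra ℂ Z → Prop} (one : P 1)
    (smul : ∀ (c : ℂ) x, P x → P (c • x)) (add : ∀ x y, P x → P y → P (x + y))
    (ι_mul : ∀ x m, P x → P (ExteriorAlgebra.ι ℂ m * x)) (x : ExteriorAlgebra ℂ Z) : P x := by
  induction x using CliffordAlgebra.left_induction with
  | algebraMap r => rw [Algebra.algebraMap_eq_smul_one]; exact smul _ _ one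
  | add x y hx hy => exact add x y hx hy
  | ι_mul x m hx => exact ι_mul x m hx

/-- The contractions generate a representation of the exterior algebra of the dual space
(with reversed order of multiplication). -/
noncomputable def contrAlg :
    ExteriorAlgebra ℂ (Module.Dual ℂ Z) →ₐ[ℂ] (Module.End ℂ (ExteriorAlgebra ℂ Z))ᵐᵒᵖ :=
  ExteriorAlgebra.lift ℂ
    ⟨(MulOpposite.opLinearEquiv ℂ).toLinearMap ∘ₗ CliffordAlgebra.contractLeft, fun d => by
      apply MulOpposite.unop_injective
      refine LinearMap.ext fun x => ?_
      exact CliffordAlgebra.contractLeft_contractLeft d x⟩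

/-- `(w₁, …, wₙ) ↦ conj (Ω | a(wₙ) ⋯ a(w₁) Φ)`. -/
noncomputable def formAux (Φ : ExteriorAlgebra ℂ Z) (n : ℕ) : Z [⋀^Fin n]→ₗ[ℂ] ℂ where
  toFun w := starRingEnd ℂ (ExteriorAlgebra.algebraMapInv
    ((contrAlg (ExteriorAlgebra.ιMulti ℂ n (fun i => innerₛₗ ℂ (w i)))).unop Φ))
  map_update_add' w i x y := by
    have h : ∀ z, (fun j => innerₛₗ ℂ (Function.update w i z j)) =
        Function.update (fun j => innerₛₗ ℂ (w j)) i (innerₛₗ ℂ z) := fun z => by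
      ext j : 1
      exact Function.apply_update (fun _ => innerₛₗ ℂ) w i z j
    simp only [h, map_add, AlternatingMap.map_update_add, MulOpposite.unop_add,
      LinearMap.add_apply]
  map_update_smul' w i c x := by
    have h : ∀ z, (fun j => innerₛₗ ℂ (Function.update w i z j)) =
        Function.update (fun j => innerₛₗ ℂ (w j)) i (innerₛₗ ℂ z) := fun z => by
      ext j : 1
      exact Function.apply_update (fun _ => innerₛₗ ℂ) w i z j
    simp only [h, map_smulₛₗ, AlternatingMap.map_update_smul, MulOpposite.unop_smul,
      LinearMap.smul_apply, smul_eq_mul, map_mul, Complex.conj_conj, RingHom.id_apply]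
  map_eq_zero_of_eq' w i j h hij := by
    rw [AlternatingMap.map_eq_zero_of_eq (ExteriorAlgebra.ιMulti ℂ n) _ (i := i) (j := j)
      (by simp [h]) hij]
    simp

/-- The scalar product of finite particle vectors, as a linear form in the second variable. -/
noncomputable def form (Φ : ExteriorAlgebra ℂ Z) : ExteriorAlgebra ℂ Z →ₗ[ℂ] ℂ :=
  ExteriorAlgebra.liftAlternating (formAux Φ)

theorem vac_ι (z : Z) : ExteriorAlgebra.algebraMapInv (ExteriorAlgebra.ι ℂ z) = (0 : ℂ) := by
  rw [ExteriorAlgebra.algebraMapInv, ExteriorAlgebra.lift_ι_apply]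
  rfl

theorem form_one_right (Φ : ExteriorAlgebra ℂ Z) :
    form Φ 1 = starRingEnd ℂ (ExteriorAlgebra.algebraMapInv Φ) := by
  simp [form, formAux]

theorem form_ι_mul_right (Φ Ψ : ExteriorAlgebra ℂ Z) (w : Z) :
    form Φ (ExteriorAlgebra.ι ℂ w * Ψ) = form (contr w Φ) Ψ := by
  rw [form, ExteriorAlgebra.liftAlternating_ι_mul, form]
  congr 2
  ext n v
  simp only [formAux, AlternatingMap.curryLeft_apply_apply]
  change starRingEnd ℂ (ExteriorAlgebra.algebraMapInv ((contrAlg (ExteriorAlgebra.ιMulti ℂ (n+1)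
    _)).unop Φ)) = starRingEnd ℂ (ExteriorAlgebra.algebraMapInv ((contrAlg (ExteriorAlgebra.ιMulti ℂ n
    _)).unop (contr w Φ)))
  rw [ExteriorAlgebra.ιMulti_succ_apply, map_mul, MulOpposite.unop_mul]
  rw [contrAlg, ExteriorAlgebra.lift_ι_apply]
  rfl

theorem form_add_left (Φ Φ' Ψ : ExteriorAlgebra ℂ Z) :
    form (Φ + Φ') Ψ = form Φ Ψ + form Φ' Ψ := by
  induction Ψ using ext_induction generalizing Φ Φ' with
  | one => simp [form_one_right]
  | smul c x h => simp [h, mul_add]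
  | add x y hx hy => simp only [map_add, hx, hy]; ring
  | ι_mul x m h => simp [form_ι_mul_right, h]

theorem form_smul_left (c : ℂ) (Φ Ψ : ExteriorAlgebra ℂ Z) :
    form (c • Φ) Ψ = starRingEnd ℂ c * form Φ Ψ := by
  induction Ψ using ext_induction generalizing Φ with
  | one => simp [form_one_right]
  | smul c' x h => simp only [map_smul, h, smul_eq_mul]; ring
  | add x y hx hy => simp only [map_add, hx, hy]; ring
  | ι_mul x m h => simp [form_ι_mul_right, h]

theorem form_zero_left (Ψ : ExteriorAlgebra ℂ Z) : form 0 Ψ = 0 := by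
  simpa using form_smul_left 0 0 Ψ

theorem form_sub_left (Φ Φ' Ψ : ExteriorAlgebra ℂ Z) :
    form (Φ - Φ') Ψ = form Φ Ψ - form Φ' Ψ := by
  rw [eq_sub_iff_add_eq, ← form_add_left, sub_add_cancel]

theorem form_ι_mul_left (Φ Ψ : ExteriorAlgebra ℂ Z) (w : Z) :
    form (ExteriorAlgebra.ι ℂ w * Φ) Ψ = form Φ (contr w Ψ) := by
  induction Ψ using ext_induction generalizing Φ with
  | one => simp [form_one_right, contr_one, vac_ι]
  | smul c x h => simp [h]
  | add x y hx hy => simp [hx, hy]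
  | ι_mul x m h =>
    rw [form_ι_mul_right, contr_ι_mul, contr_ι_mul, form_sub_left, form_smul_left, map_sub,
      map_smul, form_ι_mul_right, h, inner_conj_symm, smul_eq_mul]

theorem form_conj_symm (Φ Ψ : ExteriorAlgebra ℂ Z) :
    starRingEnd ℂ (form Ψ Φ) = form Φ Ψ := by
  induction Ψ using ext_induction generalizing Φ with
  | one =>
    rw [form_one_right]
    congr 1
    induction Φ using ext_induction with
    | one => simp [form_one_right]
    | smul c x h => simp [h]
    | add x y hx hy => simp [hx, hy]
    | ι_mul x m h => simp [form_ι_mul_right, contr_one, form_zero_left, vac_ι]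
  | smul c x h => simp [form_smul_left, h]
  | add x y hx hy => simp [form_add_left, hx, hy]
  | ι_mul x m h => rw [form_ι_mul_left, form_ι_mul_right, h]

/-- The subspace spanned by the products of the first `n` members of a sequence of vectors. -/
noncomputable def extSpan (e : ℕ → Z) : ℕ → Submodule ℂ (ExteriorAlgebra ℂ Z)
  | 0 => Submodule.span ℂ {1}
  | n + 1 => extSpan e n ⊔ (extSpan e n).map (LinearMap.mulLeft ℂ (ExteriorAlgebra.ι ℂ (e n)))

theorem ι_mul_ι_mul (x y : Z) (Ψ : ExteriorAlgebra ℂ Z) :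
    ExteriorAlgebra.ι ℂ x * (ExteriorAlgebra.ι ℂ y * Ψ) =
      - (ExteriorAlgebra.ι ℂ y * (ExteriorAlgebra.ι ℂ x * Ψ)) := by
  have h := ExteriorAlgebra.ι_add_mul_swap (R := ℂ) x y
  rw [← mul_assoc, ← mul_assoc, eq_neg_iff_add_eq_zero, ← add_mul, h, zero_mul]

theorem mem_extSpan_succ {e : ℕ → Z} {n : ℕ} {Ψ : ExteriorAlgebra ℂ Z} :
    Ψ ∈ extSpan e (n + 1) ↔ ∃ x ∈ extSpan e n, ∃ y ∈ extSpan e n,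
      x + ExteriorAlgebra.ι ℂ (e n) * y = Ψ := by
  simp [extSpan, Submodule.mem_sup]

theorem one_mem_extSpan (e : ℕ → Z) (n : ℕ) : (1 : ExteriorAlgebra ℂ Z) ∈ extSpan e n := by
  induction n with
  | zero => exact Submodule.mem_span_singleton_self 1
  | succ n ih => exact Submodule.mem_sup_left ih

theorem ι_mul_mem_extSpan (e : ℕ → Z) (n i : ℕ) (hi : i < n) (Ψ : ExteriorAlgebra ℂ Z)
    (h : Ψ ∈ extSpan e n) : ExteriorAlgebra.ι ℂ (e i) * Ψ ∈ extSpan e n := by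
  induction n generalizing Ψ with
  | zero => omega
  | succ n ih =>
    obtain ⟨x, hx, y, hy, rfl⟩ := mem_extSpan_succ.1 h
    rw [mul_add]
    rcases Nat.lt_succ_iff_lt_or_eq.1 hi with hi | rfl
    · refine mem_extSpan_succ.2 ⟨_, ih hi x hx, - (ExteriorAlgebra.ι ℂ (e i) * y),
        neg_mem (ih hi y hy), ?_⟩
      rw [ι_mul_ι_mul (e i), mul_neg]
    · refine mem_extSpan_succ.2 ⟨0, zero_mem _, x, hx, ?_⟩
      rw [← mul_assoc, ExteriorAlgebra.ι_sq_zero, zero_mul, add_zero, zero_add]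

theorem contr_extSpan (e : ℕ → Z) (n : ℕ) (w : Z) (hw : ∀ i < n, ⟪w, e i⟫_ℂ = 0)
    (Ψ : ExteriorAlgebra ℂ Z) (h : Ψ ∈ extSpan e n) : contr w Ψ = 0 := by
  induction n generalizing Ψ with
  | zero =>
    obtain ⟨c, rfl⟩ := Submodule.mem_span_singleton.1 h
    rw [map_smul, contr_one, smul_zero]
  | succ n ih =>
    obtain ⟨x, hx, y, hy, rfl⟩ := mem_extSpan_succ.1 h
    have h' := fun z hz => ih (fun i hi => hw i (by omega)) z hz
    rw [map_add, contr_ι_mul, h' x hx, h' y hy, hw n (by omega)]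
    simp

theorem form_self_extSpan (e : ℕ → Z) (n : ℕ)
    (he : ∀ i < n, ∀ j < n, ⟪e i, e j⟫_ℂ = if i = j then 1 else 0)
    (Ψ : ExteriorAlgebra ℂ Z) (h : Ψ ∈ extSpan e n) :
    0 ≤ (form Ψ Ψ).re ∧ ((form Ψ Ψ).re = 0 → Ψ = 0) := by
  induction n generalizing Ψ with
  | zero =>
    obtain ⟨c, rfl⟩ := Submodule.mem_span_singleton.1 h
    have : form (c • (1 : ExteriorAlgebra ℂ Z)) (c • 1) = (Complex.normSq c : ℂ) := by
      simp [form_one_right, Complex.mul_conj]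
    rw [this]
    refine ⟨by simpa using Complex.normSq_nonneg c, fun h => ?_⟩
    have : c = 0 := by simpa using h
    simp [this]
  | succ n ih =>
    obtain ⟨x, hx, y, hy, rfl⟩ := mem_extSpan_succ.1 h
    have ih' := fun z hz => ih (fun i hi j hj => he i (by omega) j (by omega)) z hz
    have h0 := contr_extSpan e n (e n) (fun i hi => by
      rw [he n (by omega) i (by omega), if_neg (by omega)])
    have : form (x + ExteriorAlgebra.ι ℂ (e n) * y) (x + ExteriorAlgebra.ι ℂ (e n) * y) =
        form x x + form y y := by
      rw [form_add_left, map_add, map_add, form_ι_mul_left, form_ι_mul_left, form_ι_mul_right,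
        h0 x hx, contr_ι_mul, h0 y hy, he n (by omega) n (by omega)]
      simp [form_zero_left]
    rw [this, Complex.add_re]
    obtain ⟨hx0, hx1⟩ := ih' x hx
    obtain ⟨hy0, hy1⟩ := ih' y hy
    refine ⟨add_nonneg hx0 hy0, fun h => ?_⟩
    rw [hx1 (by linarith), hy1 (by linarith)]
    simp

theorem exists_finite_support (Ψ : ExteriorAlgebra ℂ Z) :
    ∃ F : Submodule ℂ Z, FiniteDimensional ℂ F ∧ ∀ (S : Submodule ℂ (ExteriorAlgebra ℂ Z)),
      1 ∈ S → (∀ z ∈ F, ∀ x ∈ S, ExteriorAlgebra.ι ℂ z * x ∈ S) → Ψ ∈ S := by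
  induction Ψ using ext_induction with
  | one => exact ⟨⊥, inferInstance, fun S h _ => h⟩
  | smul c x h =>
    obtain ⟨F, hF, h⟩ := h
    exact ⟨F, hF, fun S h1 h2 => S.smul_mem c (h S h1 h2)⟩
  | add x y hx hy =>
    obtain ⟨F, hF, hx⟩ := hx
    obtain ⟨G, hG, hy⟩ := hy
    exact ⟨F ⊔ G, inferInstance, fun S h1 h2 => S.add_mem
      (hx S h1 fun z hz => h2 z (Submodule.mem_sup_left hz))
      (hy S h1 fun z hz => h2 z (Submodule.mem_sup_right hz))⟩
  | ι_mul x m h =>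
    obtain ⟨F, hF, h⟩ := h
    exact ⟨F ⊔ Submodule.span ℂ {m}, inferInstance, fun S h1 h2 =>
      h2 m (Submodule.mem_sup_right (Submodule.mem_span_singleton_self m)) x
        (h S h1 fun z hz => h2 z (Submodule.mem_sup_left hz))⟩

theorem form_self (Ψ : ExteriorAlgebra ℂ Z) :
    0 ≤ (form Ψ Ψ).re ∧ ((form Ψ Ψ).re = 0 → Ψ = 0) := by
  obtain ⟨F, hF, h⟩ := exists_finite_support Ψ
  let b := stdOrthonormalBasis ℂ F
  let n := Module.finrank ℂ F
  let e : ℕ → Z := fun i => if h : i < n then (b ⟨i, h⟩ : Z) else 0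
  have he : ∀ i (hi : i < n), e i = b ⟨i, hi⟩ := fun i hi => dif_pos hi
  refine form_self_extSpan e n (fun i hi j hj => ?_) Ψ (h _ (one_mem_extSpan e n) ?_)
  · rw [he i hi, he j hj, ← Submodule.coe_inner, b.inner_eq_ite]
    simp
  · intro z hz x hx
    have : z = ∑ i, (b.repr ⟨z, hz⟩ i) • (b i : Z) := by
      have := congrArg Subtype.val (b.sum_repr ⟨z, hz⟩)
      simpa using this.symm
    rw [this, map_sum, Finset.sum_mul]
    refine Submodule.sum_mem _ fun i _ => ?_
    rw [map_smul, smul_mul_assoc]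
    refine Submodule.smul_mem _ _ ?_
    have := ι_mul_mem_extSpan e n i i.2 x hx
    rwa [he i i.2] at this

/-- The scalar product of finite particle vectors. -/
noncomputable abbrev formCore : InnerProductSpace.Core ℂ (ExteriorAlgebra ℂ Z) where
  inner Φ Ψ := form Φ Ψ
  conj_inner_symm Φ Ψ := form_conj_symm Φ Ψ
  re_inner_nonneg Ψ := (form_self Ψ).1
  add_left := form_add_left
  smul_left Φ Ψ c := form_smul_left c Φ Ψ
  definite Ψ h := (form_self Ψ).2 (by rw [h]; rfl)

noncomputable instance instNormedAddCommGroupExt : NormedAddCommGroup (ExteriorAlgebra ℂ Z) :=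
  (formCore (Z := Z)).toNormedAddCommGroup

noncomputable instance instInnerProductSpaceExt : InnerProductSpace ℂ (ExteriorAlgebra ℂ Z) :=
  .ofCore (formCore (Z := Z)).toCore

theorem inner_eq_form (Φ Ψ : ExteriorAlgebra ℂ Z) : ⟪Φ, Ψ⟫_ℂ = form Φ Ψ := rfl

theorem contr_ιMulti (w : Z) (n : ℕ) (v : Fin (n + 1) → Z) :
    contr w (ExteriorAlgebra.ιMulti ℂ (n + 1) v) =
      ∑ i : Fin (n + 1), ((-1) ^ (i : ℕ) * ⟪w, v i⟫_ℂ) •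
        ExteriorAlgebra.ιMulti ℂ n (fun j => v (i.succAbove j)) := by
  induction n with
  | zero =>
    rw [ExteriorAlgebra.ιMulti_succ_apply, contr_ι_mul, ExteriorAlgebra.ιMulti_zero_apply,
      contr_one]
    simp
  | succ n ih =>
    rw [ExteriorAlgebra.ιMulti_succ_apply, contr_ι_mul, ih,
      Fin.sum_univ_succ (n := n + 1)]
    have e : ∀ i : Fin (n + 1),
        ExteriorAlgebra.ιMulti ℂ (n + 1) (fun j => v (i.succ.succAbove j)) =
        ExteriorAlgebra.ι ℂ (v 0) *
          ExteriorAlgebra.ιMulti ℂ n (fun j => Matrix.vecTail v (i.succAbove j)) := fun i => by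
      rw [ExteriorAlgebra.ιMulti_succ_apply]
      congr 2
      ext j
      simp [Matrix.vecTail]
    rw [sub_eq_add_neg, Finset.mul_sum, ← Finset.sum_neg_distrib]
    congr 1
    · simp only [Fin.val_zero, pow_zero, one_mul, Fin.succAbove_zero]
      rfl
    · refine Finset.sum_congr rfl fun i _ => ?_
      rw [e, mul_smul_comm, ← neg_smul, Fin.val_succ, pow_succ]
      congr 1
      simp [Matrix.vecTail]

/-- The scalar product is given by `(v₁ ∧ ⋯ ∧ vₙ | w₁ ∧ ⋯ ∧ wₙ) = det [(vᵢ | wⱼ)]`. -/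
theorem inner_ιMulti (n : ℕ) (v w : Fin n → Z) :
    ⟪ExteriorAlgebra.ιMulti ℂ n v, ExteriorAlgebra.ιMulti ℂ n w⟫_ℂ =
      Matrix.det (Matrix.of fun i j => ⟪v i, w j⟫_ℂ) := by
  rw [inner_eq_form]
  induction n with
  | zero => simp [form_one_right]
  | succ n ih =>
    rw [ExteriorAlgebra.ιMulti_succ_apply, form_ι_mul_left, contr_ιMulti, map_sum,
      Matrix.det_succ_row_zero]
    refine Finset.sum_congr rfl fun i _ => ?_
    rw [map_smul, ih, smul_eq_mul]
    rfl

/-- Products of different degrees are orthogonal. -/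
theorem inner_ιMulti_of_ne {n m : ℕ} (h : n ≠ m) (v : Fin n → Z) (w : Fin m → Z) :
    ⟪ExteriorAlgebra.ιMulti ℂ n v, ExteriorAlgebra.ιMulti ℂ m w⟫_ℂ = 0 := by
  rw [inner_eq_form]
  induction n generalizing m with
  | zero =>
    obtain ⟨m, rfl⟩ := Nat.exists_eq_succ_of_ne_zero (Ne.symm h)
    rw [ExteriorAlgebra.ιMulti_succ_apply, form_ι_mul_right, ExteriorAlgebra.ιMulti_zero_apply,
      contr_one, form_zero_left]
  | succ n ih =>
    rw [ExteriorAlgebra.ιMulti_succ_apply, form_ι_mul_left]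
    cases m with
    | zero => rw [ExteriorAlgebra.ιMulti_zero_apply, contr_one, map_zero]
    | succ m =>
      rw [contr_ιMulti, map_sum]
      refine Finset.sum_eq_zero fun i _ => ?_
      rw [map_smul, ih (by omega), smul_zero]

theorem norm_sq_ext (Ψ : ExteriorAlgebra ℂ Z) : ‖Ψ‖ ^ 2 = (form Ψ Ψ).re := by
  rw [← inner_eq_form, ← inner_self_eq_norm_sq (𝕜 := ℂ)]
  rfl

theorem norm_ι_mul_le (w : Z) (Ψ : ExteriorAlgebra ℂ Z) :
    ‖ExteriorAlgebra.ι ℂ w * Ψ‖ ≤ ‖w‖ * ‖Ψ‖ := by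
  refine le_of_sq_le_sq ?_ (by positivity)
  have h : form (ExteriorAlgebra.ι ℂ w * Ψ) (ExteriorAlgebra.ι ℂ w * Ψ) =
      ((‖w‖ ^ 2 : ℝ) : ℂ) * form Ψ Ψ - form (contr w Ψ) (contr w Ψ) := by
    rw [form_ι_mul_left, contr_ι_mul, map_sub, map_smul, form_ι_mul_right,
      inner_self_eq_norm_sq_to_K]
    simp
  rw [mul_pow, norm_sq_ext, norm_sq_ext, h, Complex.sub_re, Complex.re_ofReal_mul,
    ← norm_sq_ext (contr w Ψ)]
  nlinarith [sq_nonneg ‖contr w Ψ‖]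

/-- `s(N)` on finite particle vectors, for a function `s : ℕ → ℤˣ` of the number operator `N`:
multiplication by `s n` on the `n`-particle subspace. -/
noncomputable def numSignFin (s : ℕ → ℤˣ) : ExteriorAlgebra ℂ Z →ₗ[ℂ] ExteriorAlgebra ℂ Z :=
  ExteriorAlgebra.liftAlternating fun n => (((s n : ℤ) : ℂ)) • ExteriorAlgebra.ιMulti ℂ n

theorem numSignFin_ιMulti (s : ℕ → ℤˣ) (n : ℕ) (v : Fin n → Z) :
    numSignFin s (ExteriorAlgebra.ιMulti ℂ n v) =
      ((s n : ℤ) : ℂ) • ExteriorAlgebra.ιMulti ℂ n v := by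
  rw [numSignFin, ExteriorAlgebra.liftAlternating_apply_ιMulti]
  rfl

theorem numSignFin_one (s : ℕ → ℤˣ) :
    numSignFin s (1 : ExteriorAlgebra ℂ Z) = ((s 0 : ℤ) : ℂ) • 1 := by
  simpa using numSignFin_ιMulti (Z := Z) s 0 0

theorem numSignFin_ι_mul (s : ℕ → ℤˣ) (w : Z) (Ψ : ExteriorAlgebra ℂ Z) :
    numSignFin s (ExteriorAlgebra.ι ℂ w * Ψ) =
      ExteriorAlgebra.ι ℂ w * numSignFin (fun n => s (n + 1)) Ψ := by
  rw [numSignFin, ExteriorAlgebra.liftAlternating_ι_mul, numSignFin]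
  rw [← LinearMap.mulLeft_apply (R := ℂ), ← LinearMap.comp_apply,
    ← ExteriorAlgebra.liftAlternating_comp]
  congr 2
  ext n v
  simp [Matrix.vecTail, Function.comp_def]

theorem contr_numSignFin (s : ℕ → ℤˣ) (w : Z) (Ψ : ExteriorAlgebra ℂ Z) :
    contr w (numSignFin (fun n => s n) Ψ) = numSignFin (fun n => s (n + 1)) (contr w Ψ) := by
  induction Ψ using ext_induction generalizing s with
  | one => simp [numSignFin_one, contr_one]
  | smul c x h => simp [h]
  | add x y hx hy => simp [hx, hy]
  | ι_mul x m h => simp [numSignFin_ι_mul, contr_ι_mul, h]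

theorem form_numSignFin (s : ℕ → ℤˣ) (Φ Ψ : ExteriorAlgebra ℂ Z) :
    form (numSignFin s Φ) (numSignFin s Ψ) = form Φ Ψ := by
  induction Ψ using ext_induction generalizing s Φ with
  | one =>
    have h : ∀ Φ : ExteriorAlgebra ℂ Z, form 1 (numSignFin s Φ) = ((s 0 : ℤ) : ℂ) * form 1 Φ := by
      intro Φ
      induction Φ using ext_induction with
      | one => simp [numSignFin_one]
      | smul c x h => simp only [map_smul, h, smul_eq_mul]; ring
      | add x y hx hy => simp only [map_add, hx, hy]; ring
      | ι_mul x m h => simp [numSignFin_ι_mul, form_ι_mul_right, contr_one, form_zero_left]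
    rw [numSignFin_one, map_smul, ← form_conj_symm, h, ← form_conj_symm Φ]
    rcases Int.units_eq_one_or (s 0) with h | h <;> simp [h]
  | smul c x h => simp [h]
  | add x y hx hy => simp [hx, hy]
  | ι_mul x m h =>
    rw [numSignFin_ι_mul, form_ι_mul_right, form_ι_mul_right, contr_numSignFin, h]

theorem norm_numSignFin (s : ℕ → ℤˣ) (Ψ : ExteriorAlgebra ℂ Z) : ‖numSignFin s Ψ‖ = ‖Ψ‖ := by
  have : ‖numSignFin s Ψ‖ ^ 2 = ‖Ψ‖ ^ 2 := by
    rw [norm_sq_ext, norm_sq_ext, form_numSignFin]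
  exact (sq_eq_sq₀ (norm_nonneg _) (norm_nonneg _)).1 this

end FiniteParticle

section FockSpace

/-- The fermionic Fock space `Γ_a(Z)`: the completion of the exterior algebra of `Z` with respect
to the scalar product for which different degrees are orthogonal and
`(v₁ ∧ ⋯ ∧ vₙ | w₁ ∧ ⋯ ∧ wₙ) = det [(vᵢ | wⱼ)]`. The element `v₁ ∧ ⋯ ∧ vₙ` of the exterior algebra
is the normalized antisymmetric tensor
`√(n!) v₁ ⊗ₐ ⋯ ⊗ₐ vₙ = (n!)^(-1/2) ∑ sgn(σ) v_σ(1) ⊗ ⋯ ⊗ v_σ(n)` of the `n`-fold Hilbert space tensor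
power of `Z`, and `Γ_a(Z)` is the Hilbert space direct sum of its `n`-particle subspaces. -/
abbrev Fock (Z : Type*) [NormedAddCommGroup Z] [InnerProductSpace ℂ Z] : Type _ :=
  Completion (ExteriorAlgebra ℂ Z)

variable {Z : Type*} [NormedAddCommGroup Z] [InnerProductSpace ℂ Z]

/-- The creation operator `a*(w)`, the closure of `Ψ ↦ w ∧ Ψ`. On an `n`-particle vector this is
`√(n+1) w ⊗ₐ Ψ`, in view of the normalization of the exterior product. -/
noncomputable def creation (w : Z) : Fock Z →L[ℂ] Fock Z :=
  ((LinearMap.mulLeft ℂ (ExteriorAlgebra.ι ℂ w)).mkContinuous ‖w‖ (norm_ι_mul_le w)).completion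

/-- The annihilation operator `a(w) = a*(w)*`. -/
noncomputable def annihilation (w : Z) : Fock Z →L[ℂ] Fock Z :=
  ContinuousLinearMap.adjoint (creation w)

/-- The fermionic field operator `φ(w) = a*(w) + a(w)`. -/
noncomputable def field (w : Z) : Fock Z →L[ℂ] Fock Z :=
  creation w + annihilation w

/-- The operator `s(N)`, where `N` is the number operator and `s : ℕ → ℤˣ`. -/
noncomputable def numSign (s : ℕ → ℤˣ) : Fock Z →L[ℂ] Fock Z :=
  ((numSignFin s).mkContinuous 1 fun Ψ => by rw [norm_numSignFin, one_mul]).completion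

variable (Z) in
/-- The parity operator `I = (-1)^N`. -/
noncomputable def parity : Fock Z →L[ℂ] Fock Z :=
  numSign fun n => (-1) ^ n

variable (Z) in
/-- The operator `Λ = (-1)^(N(N-1)/2)`. -/
noncomputable def Lam : Fock Z →L[ℂ] Fock Z :=
  numSign fun n => (-1) ^ (n * (n - 1) / 2)

/-- The von Neumann algebra `M(V) = {φ(z) : z ∈ V}''`, for a real subspace `V` of `Z`. -/
def fieldAlgebra (V : Submodule ℝ Z) : Set (Fock Z →L[ℂ] Fock Z) :=
  Set.centralizer (Set.centralizer (field '' (V : Set Z)))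

end FockSpace

section Tensor

/-- The tensor product of two Hilbert spaces, as a Hilbert space. -/
abbrev HTensor (H K : Type*) [NormedAddCommGroup H] [InnerProductSpace ℂ H]
    [NormedAddCommGroup K] [InnerProductSpace ℂ K] : Type _ :=
  Completion (H ⊗[ℂ] K)

variable {H K : Type*} [NormedAddCommGroup H] [InnerProductSpace ℂ H]
  [NormedAddCommGroup K] [InnerProductSpace ℂ K]

/-- The bounded operator `A ⊗ B` on the Hilbert space tensor product,
`(A ⊗ B)(h ⊗ k) = A h ⊗ B k`. -/
noncomputable def opTensor (A : H →L[ℂ] H) (B : K →L[ℂ] K) : HTensor H K →L[ℂ] HTensor H K :=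
  (TensorProduct.mapL A B).completion

theorem opTensor_tmul (A : H →L[ℂ] H) (B : K →L[ℂ] K) (h : H) (k : K) :
    opTensor A B ((h ⊗ₜ[ℂ] k : H ⊗[ℂ] K) : HTensor H K) =
      ((A h ⊗ₜ[ℂ] B k : H ⊗[ℂ] K) : HTensor H K) := by
  simp [opTensor]

/-- The tensor product of von Neumann algebras, generated by the operators `A ⊗ B` with
`A ∈ M` and `B ∈ N`. -/
def algTensor (M : Set (H →L[ℂ] H)) (N : Set (K →L[ℂ] K)) :
    Set (HTensor H K →L[ℂ] HTensor H K) :=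
  Set.centralizer (Set.centralizer (Set.image2 opTensor M N))

end Tensor

section Exponential

variable (W₁ W₂ : Type*) [NormedAddCommGroup W₁] [InnerProductSpace ℂ W₁]
  [NormedAddCommGroup W₂] [InnerProductSpace ℂ W₂]

/-- `(-1)^(N₁ ⊗ N₂)`, written as `P₊ ⊗ 1 + P₋ ⊗ (-1)^N₂` with the projections
`P₊ = (1 + (-1)^N₁) / 2` and `P₋ = (1 - (-1)^N₁) / 2` onto even and odd particle numbers. -/
noncomputable def twist : HTensor (Fock W₁) (Fock W₂) →L[ℂ] HTensor (Fock W₁) (Fock W₂) :=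
  opTensor ((1 / 2 : ℂ) • (1 + parity W₁)) 1 + opTensor ((1 / 2 : ℂ) • (1 - parity W₁)) (parity W₂)

theorem parity_ιMulti {Z : Type*} [NormedAddCommGroup Z] [InnerProductSpace ℂ Z] (n : ℕ)
    (v : Fin n → Z) :
    parity Z ((ExteriorAlgebra.ιMulti ℂ n v : ExteriorAlgebra ℂ Z) : Fock Z) =
      ((-1 : ℂ) ^ n) • ((ExteriorAlgebra.ιMulti ℂ n v : ExteriorAlgebra ℂ Z) : Fock Z) := by
  simp [parity, numSign, numSignFin_ιMulti, Completion.coe_smul]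

/-- `(-1)^(N₁ ⊗ N₂)` multiplies the tensor product of an `n`-particle and an `m`-particle vector
by `(-1)^(n m)`. -/
theorem twist_ιMulti (n m : ℕ) (v : Fin n → W₁) (w : Fin m → W₂) :
    twist W₁ W₂ ((((ExteriorAlgebra.ιMulti ℂ n v : ExteriorAlgebra ℂ W₁) : Fock W₁) ⊗ₜ[ℂ]
        ((ExteriorAlgebra.ιMulti ℂ m w : ExteriorAlgebra ℂ W₂) : Fock W₂) :
          Fock W₁ ⊗[ℂ] Fock W₂) : HTensor (Fock W₁) (Fock W₂)) =
      ((-1 : ℂ) ^ (n * m)) •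
      ((((ExteriorAlgebra.ιMulti ℂ n v : ExteriorAlgebra ℂ W₁) : Fock W₁) ⊗ₜ[ℂ]
        ((ExteriorAlgebra.ιMulti ℂ m w : ExteriorAlgebra ℂ W₂) : Fock W₂) :
          Fock W₁ ⊗[ℂ] Fock W₂) : HTensor (Fock W₁) (Fock W₂)) := by
  rw [twist, add_apply, opTensor_tmul, opTensor_tmul]
  simp only [smul_apply, add_apply,
    sub_apply, one_apply_eq_self, parity_ιMulti]
  rcases Nat.even_or_odd n with hn | hn
  · have : ((-1 : ℂ)) ^ (n * m) = 1 := (hn.mul_right m).neg_one_pow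
    rw [hn.neg_one_pow, this, one_smul, sub_self, smul_zero, TensorProduct.zero_tmul,
      Completion.coe_zero, add_zero, ← two_smul ℂ, smul_smul]
    norm_num
  · rw [pow_mul, hn.neg_one_pow, neg_one_smul, add_neg_cancel, smul_zero, TensorProduct.zero_tmul,
      Completion.coe_zero, zero_add, sub_neg_eq_add, ← two_smul ℂ, smul_smul,
      TensorProduct.tmul_smul, ← Completion.coe_smul]
    norm_num


/-- The embedding `j₁` of `W₁` into the Hilbert space direct sum `W₁ ⊕ W₂`. -/
noncomputable def inlH : W₁ →ₗ[ℂ] WithLp 2 (W₁ × W₂) :=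
  (WithLp.linearEquiv 2 ℂ (W₁ × W₂)).symm.toLinearMap ∘ₗ LinearMap.inl ℂ W₁ W₂

/-- The embedding `j₂` of `W₂` into the Hilbert space direct sum `W₁ ⊕ W₂`. -/
noncomputable def inrH : W₂ →ₗ[ℂ] WithLp 2 (W₁ × W₂) :=
  (WithLp.linearEquiv 2 ℂ (W₁ × W₂)).symm.toLinearMap ∘ₗ LinearMap.inr ℂ W₁ W₂

theorem inner_inl_inl (v w : W₁) : ⟪inlH W₁ W₂ v, inlH W₁ W₂ w⟫_ℂ = ⟪v, w⟫_ℂ := by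
  simp [inlH, WithLp.prod_inner_apply]

theorem inner_inr_inr (v w : W₂) : ⟪inrH W₁ W₂ v, inrH W₁ W₂ w⟫_ℂ = ⟪v, w⟫_ℂ := by
  simp [inrH, WithLp.prod_inner_apply]

theorem inner_inl_inr (v : W₁) (w : W₂) : ⟪inlH W₁ W₂ v, inrH W₁ W₂ w⟫_ℂ = 0 := by
  simp [inlH, inrH, WithLp.prod_inner_apply]

/-- The exponential law on finite particle vectors, `Ψ₁ ⊗ Ψ₂ ↦ (Γ(j₁) Ψ₁) ∧ (Γ(j₂) Ψ₂)`. -/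
noncomputable def expFin :
    ExteriorAlgebra ℂ W₁ ⊗[ℂ] ExteriorAlgebra ℂ W₂ →ₗ[ℂ] ExteriorAlgebra ℂ (WithLp 2 (W₁ × W₂)) :=
  LinearMap.mul' ℂ _ ∘ₗ TensorProduct.map
    (ExteriorAlgebra.map (inlH W₁ W₂)).toLinearMap (ExteriorAlgebra.map (inrH W₁ W₂)).toLinearMap

variable {W₁ W₂}

theorem expFin_tmul (Ψ₁ : ExteriorAlgebra ℂ W₁) (Ψ₂ : ExteriorAlgebra ℂ W₂) :
    expFin W₁ W₂ (Ψ₁ ⊗ₜ Ψ₂) =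
      ExteriorAlgebra.map (inlH W₁ W₂) Ψ₁ * ExteriorAlgebra.map (inrH W₁ W₂) Ψ₂ := by
  simp [expFin]

theorem contr_map_inr (w : W₁) (Ψ : ExteriorAlgebra ℂ W₂) :
    contr (inlH W₁ W₂ w) (ExteriorAlgebra.map (inrH W₁ W₂) Ψ) = 0 := by
  induction Ψ using ext_induction with
  | one => simp [contr_one]
  | smul c x h => simp [h]
  | add x y hx hy => simp [hx, hy]
  | ι_mul x m h =>
    rw [map_mul, ExteriorAlgebra.map_apply_ι, contr_ι_mul, h, inner_inl_inr]
    simp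

theorem contr_map_inl_mul (w : W₁) (Ψ₁ : ExteriorAlgebra ℂ W₁) (Ψ₂ : ExteriorAlgebra ℂ W₂) :
    contr (inlH W₁ W₂ w)
        (ExteriorAlgebra.map (inlH W₁ W₂) Ψ₁ * ExteriorAlgebra.map (inrH W₁ W₂) Ψ₂) =
      ExteriorAlgebra.map (inlH W₁ W₂) (contr w Ψ₁) * ExteriorAlgebra.map (inrH W₁ W₂) Ψ₂ := by
  induction Ψ₁ using ext_induction with
  | one => simp [contr_one, contr_map_inr]
  | smul c x h => simp [h]
  | add x y hx hy => simp [hx, hy, add_mul]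
  | ι_mul x m h =>
    rw [map_mul (ExteriorAlgebra.map (inlH W₁ W₂)), ExteriorAlgebra.map_apply_ι, mul_assoc, contr_ι_mul, h,
      inner_inl_inl, contr_ι_mul]
    simp [sub_mul, mul_assoc]

theorem form_map_inr (Φ Ψ : ExteriorAlgebra ℂ W₂) :
    form (ExteriorAlgebra.map (inrH W₁ W₂) Φ) (ExteriorAlgebra.map (inrH W₁ W₂) Ψ) = form Φ Ψ := by
  have hc : ∀ (w : W₂) (Ψ : ExteriorAlgebra ℂ W₂),
      contr (inrH W₁ W₂ w) (ExteriorAlgebra.map (inrH W₁ W₂) Ψ) =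
        ExteriorAlgebra.map (inrH W₁ W₂) (contr w Ψ) := by
    intro w Ψ
    induction Ψ using ext_induction with
    | one => simp [contr_one]
    | smul c x h => simp [h]
    | add x y hx hy => simp [hx, hy]
    | ι_mul x m h =>
      rw [map_mul, ExteriorAlgebra.map_apply_ι, contr_ι_mul, h, inner_inr_inr, contr_ι_mul]
      simp
  induction Φ using ext_induction generalizing Ψ with
  | one =>
    induction Ψ using ext_induction with
    | one => simp [form_one_right]
    | smul c x h => rw [map_smul, map_smul, map_smul, h]
    | add x y hx hy => rw [map_add, map_add, map_add, hx, hy]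
    | ι_mul x m h =>
      rw [map_mul, ExteriorAlgebra.map_apply_ι, form_ι_mul_right, hc, form_ι_mul_right, contr_one,
        map_zero, form_zero_left, form_zero_left]
  | smul c x h => rw [map_smul, form_smul_left, form_smul_left, h]
  | add x y hx hy => rw [map_add, form_add_left, form_add_left, hx, hy]
  | ι_mul x m h =>
    rw [map_mul, ExteriorAlgebra.map_apply_ι, form_ι_mul_left, form_ι_mul_left, hc, h]

theorem form_expFin_tmul (Φ₁ Ψ₁ : ExteriorAlgebra ℂ W₁) (Φ₂ Ψ₂ : ExteriorAlgebra ℂ W₂) :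
    form (expFin W₁ W₂ (Φ₁ ⊗ₜ Φ₂)) (expFin W₁ W₂ (Ψ₁ ⊗ₜ Ψ₂)) = form Φ₁ Ψ₁ * form Φ₂ Ψ₂ := by
  rw [expFin_tmul, expFin_tmul]
  induction Φ₁ using ext_induction generalizing Ψ₁ with
  | one =>
    rw [map_one, one_mul]
    induction Ψ₁ using ext_induction with
    | one => simp [form_one_right, form_map_inr]
    | smul c x h => rw [map_smul, smul_mul_assoc, map_smul, h, map_smul, smul_mul_assoc]
    | add x y hx hy => rw [map_add, add_mul, map_add, hx, hy, map_add, add_mul]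
    | ι_mul x m h =>
      rw [map_mul (ExteriorAlgebra.map (inlH W₁ W₂)), ExteriorAlgebra.map_apply_ι, mul_assoc,
        form_ι_mul_right, contr_map_inr,
        form_ι_mul_right, contr_one, form_zero_left, form_zero_left, zero_mul]
  | smul c x h => rw [map_smul, smul_mul_assoc, form_smul_left, h, form_smul_left, mul_assoc]
  | add x y hx hy => rw [map_add, add_mul, form_add_left, hx, hy, form_add_left, add_mul]
  | ι_mul x m h =>
    rw [map_mul (ExteriorAlgebra.map (inlH W₁ W₂)), ExteriorAlgebra.map_apply_ι, mul_assoc,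
        form_ι_mul_left, form_ι_mul_left,
      contr_map_inl_mul, h]

theorem inner_expFin (X Y : ExteriorAlgebra ℂ W₁ ⊗[ℂ] ExteriorAlgebra ℂ W₂) :
    ⟪expFin W₁ W₂ X, expFin W₁ W₂ Y⟫_ℂ = ⟪X, Y⟫_ℂ := by
  induction X using TensorProduct.induction_on with
  | zero => simp
  | add x y hx hy => rw [map_add, inner_add_left, inner_add_left, hx, hy]
  | tmul Φ₁ Φ₂ =>
    induction Y using TensorProduct.induction_on with
    | zero => simp
    | add x y hx hy => rw [map_add, inner_add_right, inner_add_right, hx, hy]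
    | tmul Ψ₁ Ψ₂ =>
      rw [inner_eq_form, form_expFin_tmul, TensorProduct.inner_tmul, inner_eq_form, inner_eq_form]

theorem ι_inr_mul_map_inl (w : W₂) (Ψ : ExteriorAlgebra ℂ W₁) :
    ∃ Ψ', ExteriorAlgebra.ι ℂ (inrH W₁ W₂ w) * ExteriorAlgebra.map (inlH W₁ W₂) Ψ =
      ExteriorAlgebra.map (inlH W₁ W₂) Ψ' * ExteriorAlgebra.ι ℂ (inrH W₁ W₂ w) := by
  induction Ψ using ext_induction with
  | one => exact ⟨1, by simp⟩
  | smul c x h => obtain ⟨y, h⟩ := h; exact ⟨c • y, by simp [h]⟩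
  | add x y hx hy =>
    obtain ⟨x', hx⟩ := hx
    obtain ⟨y', hy⟩ := hy
    exact ⟨x' + y', by simp [mul_add, add_mul, hx, hy]⟩
  | ι_mul x m h =>
    obtain ⟨y, h⟩ := h
    refine ⟨-(ExteriorAlgebra.ι ℂ m * y), ?_⟩
    rw [map_mul, ExteriorAlgebra.map_apply_ι, ι_mul_ι_mul, h, map_neg, map_mul,
      ExteriorAlgebra.map_apply_ι, neg_mul, mul_assoc]

theorem expFin_surjective : Function.Surjective (expFin W₁ W₂) := by
  intro Ψ
  induction Ψ using ext_induction with
  | one => exact ⟨1 ⊗ₜ 1, by simp [expFin_tmul]⟩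
  | smul c x h => obtain ⟨X, rfl⟩ := h; exact ⟨c • X, map_smul _ _ _⟩
  | add x y hx hy =>
    obtain ⟨X, rfl⟩ := hx
    obtain ⟨Y, rfl⟩ := hy
    exact ⟨X + Y, map_add _ _ _⟩
  | ι_mul x m h =>
    obtain ⟨X, rfl⟩ := h
    have hm : m = inlH W₁ W₂ m.fst + inrH W₁ W₂ m.snd := by
      apply WithLp.ofLp_injective
      ext <;> simp [inlH, inrH]
    change _ ∈ LinearMap.range (expFin W₁ W₂)
    induction X using TensorProduct.induction_on with
    | zero => simp
    | add x y hx hy => rw [map_add, mul_add]; exact add_mem hx hy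
    | tmul Ψ₁ Ψ₂ =>
      rw [hm, map_add, add_mul]
      refine add_mem ⟨(ExteriorAlgebra.ι ℂ m.fst * Ψ₁) ⊗ₜ Ψ₂, ?_⟩ ?_
      · rw [expFin_tmul, expFin_tmul, map_mul, ExteriorAlgebra.map_apply_ι, mul_assoc]
      · obtain ⟨Ψ', h⟩ := ι_inr_mul_map_inl (W₁ := W₁) m.snd Ψ₁
        refine ⟨Ψ' ⊗ₜ (ExteriorAlgebra.ι ℂ m.snd * Ψ₂), ?_⟩
        rw [expFin_tmul, expFin_tmul, map_mul, ExteriorAlgebra.map_apply_ι, ← mul_assoc, ← mul_assoc,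
          h]

variable (W₁ W₂)

/-- The exponential law on finite particle vectors as a unitary map. -/
noncomputable def expFinEquiv :
    ExteriorAlgebra ℂ W₁ ⊗[ℂ] ExteriorAlgebra ℂ W₂ ≃ₗᵢ[ℂ]
      ExteriorAlgebra ℂ (WithLp 2 (W₁ × W₂)) :=
  LinearIsometryEquiv.ofSurjective ((expFin W₁ W₂).isometryOfInner inner_expFin) expFin_surjective

/-- The embedding of the algebraic tensor product of the spaces of finite particle vectors
into the Hilbert space tensor product of the Fock spaces. -/
noncomputable def toHTensor :
    ExteriorAlgebra ℂ W₁ ⊗[ℂ] ExteriorAlgebra ℂ W₂ →ₗᵢ[ℂ] HTensor (Fock W₁) (Fock W₂) :=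
  Completion.toComplₗᵢ.comp (TensorProduct.mapIsometry Completion.toComplₗᵢ Completion.toComplₗᵢ)

theorem denseRange_mapIsometry : DenseRange (TensorProduct.mapIsometry
    (Completion.toComplₗᵢ : ExteriorAlgebra ℂ W₁ →ₗᵢ[ℂ] Fock W₁)
    (Completion.toComplₗᵢ : ExteriorAlgebra ℂ W₂ →ₗᵢ[ℂ] Fock W₂)) := by
  let S := LinearMap.range (TensorProduct.mapIsometry
      (Completion.toComplₗᵢ : ExteriorAlgebra ℂ W₁ →ₗᵢ[ℂ] Fock W₁)
      (Completion.toComplₗᵢ : ExteriorAlgebra ℂ W₂ →ₗᵢ[ℂ] Fock W₂)).toLinearMap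
  have key : ∀ X : Fock W₁ ⊗[ℂ] Fock W₂, X ∈ S.topologicalClosure := by
    intro X
    induction X using TensorProduct.induction_on with
    | zero => exact zero_mem _
    | add x y hx hy => exact add_mem hx hy
    | tmul x y =>
      refine Completion.induction_on₂ x y ?_ fun a b => ?_
      · exact S.isClosed_topologicalClosure.preimage TensorProduct.continuous_tmul
      · exact S.le_topologicalClosure ⟨a ⊗ₜ b, rfl⟩
  exact fun X => key X

theorem denseRange_toHTensor : DenseRange (toHTensor W₁ W₂) :=
  (Completion.denseRange_coe (α := Fock W₁ ⊗[ℂ] Fock W₂)).comp (denseRange_mapIsometry W₁ W₂)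
    (Completion.continuous_coe _)

/-- The exponential law `U : Γ_a(W₁) ⊗ Γ_a(W₂) → Γ_a(W₁ ⊕ W₂)`, the unitary operator with
`U (Ψ₁ ⊗ Ψ₂) = (Γ(j₁) Ψ₁) ∧ (Γ(j₂) Ψ₂)` for finite particle vectors. If `Ψ₁` has `n` and `Ψ₂` has
`m` particles, the right-hand side is `√((n+m)!/(n! m!)) (Γ(j₁) Ψ₁) ⊗ₐ (Γ(j₂) Ψ₂)`, in view of the
normalization of the exterior product. -/
noncomputable def expLaw :
    HTensor (Fock W₁) (Fock W₂) ≃ₗᵢ[ℂ] Fock (WithLp 2 (W₁ × W₂)) :=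
  (expFinEquiv W₁ W₂).toLinearEquiv.extendOfIsometry (toHTensor W₁ W₂).toLinearMap
    (Completion.toComplₗᵢ : ExteriorAlgebra ℂ (WithLp 2 (W₁ × W₂)) →ₗᵢ[ℂ] _).toLinearMap
    (denseRange_toHTensor W₁ W₂) Completion.denseRange_coe (fun X => by
      rw [LinearIsometry.coe_toLinearMap, LinearIsometry.coe_toLinearMap, LinearIsometry.norm_map,
        LinearIsometry.norm_map]
      exact (expFinEquiv W₁ W₂).norm_map X)

theorem expLaw_tmul (Ψ₁ : ExteriorAlgebra ℂ W₁) (Ψ₂ : ExteriorAlgebra ℂ W₂) :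
    expLaw W₁ W₂ ((((Ψ₁ : Fock W₁) ⊗ₜ[ℂ] (Ψ₂ : Fock W₂) : Fock W₁ ⊗[ℂ] Fock W₂)) :
        HTensor (Fock W₁) (Fock W₂)) =
      ((ExteriorAlgebra.map (inlH W₁ W₂) Ψ₁ * ExteriorAlgebra.map (inrH W₁ W₂) Ψ₂ :
        ExteriorAlgebra ℂ (WithLp 2 (W₁ × W₂))) : Fock (WithLp 2 (W₁ × W₂))) := by
  have h := LinearEquiv.extendOfIsometry_eq (expFinEquiv W₁ W₂).toLinearEquiv
    (toHTensor W₁ W₂).toLinearMap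
    (Completion.toComplₗᵢ : ExteriorAlgebra ℂ (WithLp 2 (W₁ × W₂)) →ₗᵢ[ℂ] _).toLinearMap
    (denseRange_toHTensor W₁ W₂) Completion.denseRange_coe (fun X => by
      rw [LinearIsometry.coe_toLinearMap, LinearIsometry.coe_toLinearMap, LinearIsometry.norm_map,
        LinearIsometry.norm_map]
      exact (expFinEquiv W₁ W₂).norm_map X) (Ψ₁ ⊗ₜ Ψ₂)
  rw [← expFin_tmul]
  exact h

/-- The direct sum `V₁ ⊕ V₂` of real subspaces, as a real subspace of `W₁ ⊕ W₂`. -/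
def realSum {W₁ W₂ : Type*} [NormedAddCommGroup W₁] [InnerProductSpace ℂ W₁]
    [NormedAddCommGroup W₂] [InnerProductSpace ℂ W₂]
    (V₁ : Submodule ℝ W₁) (V₂ : Submodule ℝ W₂) : Submodule ℝ (WithLp 2 (W₁ × W₂)) where
  carrier := {x | x.fst ∈ V₁ ∧ x.snd ∈ V₂}
  zero_mem' := ⟨V₁.zero_mem, V₂.zero_mem⟩
  add_mem' hx hy := ⟨V₁.add_mem hx.1 hy.1, V₂.add_mem hx.2 hy.2⟩
  smul_mem' c _ hx := ⟨V₁.smul_mem c hx.1, V₂.smul_mem c hx.2⟩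

end Exponential
end FermiFock

open FermiFock

namespace FermiFock

/-! ### Commutants under isomorphisms and sums. -/

section Commutant

/-! Under the exponential law the field `φ(w₁ ⊕ w₂)` becomes `φ(w₁) ⊗ 1 + (-1)^N₁ ⊗ φ(w₂)`
(`conj_expLaw_field`), the sign arising because a creation operator of the second summand must pass
all particles of the first. Since `0` lies in both real subspaces, the commutant of these sums is
the intersection of the commutants of `φ(V₁) ⊗ 1` and `(-1)^N₁ ⊗ φ(V₂)`; this is
`fieldAlgebra_realSum`, from which everything else is read off.

The sign `(-1)^N₁` is handled in two ways. Fields are odd, so conjugating `1 ⊗ φ(v)` by the twist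
`(-1)^(N₁ ⊗ N₂)` gives exactly `(-1)^N₁ ⊗ φ(v)` (`twist_conj_right`), whence the general formula. If
`V₁ = W₁`, irreducibility of the Fock representation gives `M(W₁) = B(Γ_a(W₁))`, so `(-1)^N₁ ⊗ 1`
already belongs to the algebra and can be cancelled.

For the formulas with `Λ`, the identity `C(n+m,2) = C(n,2) + C(m,2) + nm` shows that `Λ` corresponds
to the twist times `Λ₁ ⊗ Λ₂` (`conj_expLaw_Lam`). Conjugation by it moves the sign to the other
factor: the generators become `Λ₁φ(v₁)Λ₁ ⊗ (-1)^N₂` and `1 ⊗ Λ₂φ(v₂)Λ₂`, and the previous arguments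
apply with the factors exchanged.

Passing from generators to von Neumann algebras rests on two facts about `A ↦ A ⊗ 1`, proved by
slicing: `S ⊗ 1` and `S'' ⊗ 1` have the same commutant, and `(S ⊗ 1)'' = S'' ⊗ 1`. -/

theorem image_centralizer {R S : Type*} [Mul R] [Mul S] (e : R ≃* S) (X : Set R) :
    e '' Set.centralizer X = Set.centralizer (e '' X) := by
  ext y
  constructor
  · rintro ⟨x, hx, rfl⟩ _ ⟨m, hm, rfl⟩
    rw [← map_mul, ← map_mul, hx m hm]
  · refine fun h => ⟨e.symm y, fun m hm => e.injective ?_, e.apply_symm_apply y⟩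
    rw [map_mul, map_mul, e.apply_symm_apply, h _ ⟨m, hm, rfl⟩]

/-- Conjugation by an involution. -/
def involutionConj {R : Type*} [Monoid R] (u : R) (hu : u * u = 1) : R ≃* R where
  toFun A := u * A * u
  invFun A := u * A * u
  left_inv A := by
    beta_reduce
    rw [show u * (u * A * u) * u = (u * u) * A * (u * u) by simp only [mul_assoc], hu, one_mul,
      mul_one]
  right_inv A := by
    beta_reduce
    rw [show u * (u * A * u) * u = (u * u) * A * (u * u) by simp only [mul_assoc], hu, one_mul,
      mul_one]
  map_mul' A B := by
    rw [show u * A * u * (u * B * u) = u * A * (u * u) * B * u by simp only [mul_assoc], hu,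
      mul_one, mul_assoc u A B]

/-- The zeros make `S` and `T` subsets of `S + T`; without them only one inclusion would remain. -/
theorem centralizer_add {R : Type*} [Ring R] {S T : Set R} (hS : 0 ∈ S) (hT : 0 ∈ T) :
    Set.centralizer (S + T) = Set.centralizer S ∩ Set.centralizer T := by
  ext x
  constructor
  · exact fun h => ⟨fun s hs => h s ⟨s, hs, 0, hT, add_zero s⟩,
      fun t ht => h t ⟨0, hS, t, ht, zero_add t⟩⟩
  · rintro ⟨h₁, h₂⟩ _ ⟨s, hs, t, ht, rfl⟩
    simp only [add_mul, mul_add, h₁ s hs, h₂ t ht]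

end Commutant

/-! ### Slices, and the bicommutant of an amplification. -/

section Amplification

variable {H G ι : Type*} [NormedAddCommGroup H] [InnerProductSpace ℂ H] [CompleteSpace H]
  [NormedAddCommGroup G] [InnerProductSpace ℂ G] [CompleteSpace G]

/-- A map `π` such as `A ↦ A ⊗ 1`, together with a separating family of intertwiners
such as `h ↦ h ⊗ k`. -/
structure Amplification (π : (H →L[ℂ] H) → (G →L[ℂ] G)) (V : ι → (H →L[ℂ] G)) : Prop where
  intertwine : ∀ A i, π A ∘L V i = V i ∘L A
  map_adjoint : ∀ A, ContinuousLinearMap.adjoint (π A) = π (ContinuousLinearMap.adjoint A)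
  ext : ∀ X Y : G →L[ℂ] G, (∀ i, X ∘L V i = Y ∘L V i) → X = Y
  exists_isometry : ∃ i, ContinuousLinearMap.adjoint (V i) ∘L V i = 1

namespace Amplification

open ContinuousLinearMap

variable {π : (H →L[ℂ] H) → (G →L[ℂ] G)} {V : ι → (H →L[ℂ] G)}

theorem adjoint_intertwine (h : Amplification π V) (A : H →L[ℂ] H) (i : ι) :
    adjoint (V i) ∘L π A = A ∘L adjoint (V i) := by
  have := congrArg adjoint (h.intertwine (adjoint A) i)
  rwa [adjoint_comp, adjoint_comp, h.map_adjoint, adjoint_adjoint] at this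

/-- The operators `adjoint (V i) ∘L X ∘L V j` are the matrix entries of `X`. Separation by the `V i`
is used twice, once on each side, with an adjoint in between. -/
theorem ext_slices (h : Amplification π V) {X Y : G →L[ℂ] G}
    (hXY : ∀ i j, adjoint (V i) ∘L X ∘L V j = adjoint (V i) ∘L Y ∘L V j) : X = Y := by
  refine h.ext _ _ fun j => ?_
  obtain ⟨o, ho⟩ := h.exists_isometry
  -- The field `ext` concerns endomorphisms of `G`, so the map `G → H` is first composed with the
  -- isometry `V o`, which is cancelled in `h₂`.
  have h₁ : V o ∘L adjoint ((X - Y) ∘L V j) = 0 := h.ext _ _ fun i => by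
    have : adjoint ((X - Y) ∘L V j) ∘L V i = 0 := by
      apply adjoint.injective
      rw [adjoint_comp, adjoint_adjoint, sub_comp, comp_sub, hXY, sub_self, map_zero]
    rw [comp_assoc, this, comp_zero, zero_comp]
  have h₂ : adjoint ((X - Y) ∘L V j) = 0 := by
    calc _ = (adjoint (V o) ∘L V o) ∘L adjoint ((X - Y) ∘L V j) := by rw [ho]; rfl
      _ = _ := by rw [comp_assoc, h₁, comp_zero]
  rw [← sub_eq_zero, ← sub_comp]
  exact adjoint.injective (h₂.trans (map_zero _).symm)

/-- By the intertwining relations, slicing turns multiplication by `π A` into multiplication by `A`,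
and slices determine the operator. -/
theorem commute_iff (h : Amplification π V) (X : G →L[ℂ] G) (A : H →L[ℂ] H) :
    π A * X = X * π A ↔
      ∀ i j, A * (adjoint (V i) ∘L X ∘L V j) = (adjoint (V i) ∘L X ∘L V j) * A := by
  have h₁ : ∀ i j, A * (adjoint (V i) ∘L X ∘L V j) = adjoint (V i) ∘L (π A * X) ∘L V j := by
    intro i j
    calc _ = (A ∘L adjoint (V i)) ∘L X ∘L V j := rfl
      _ = _ := by rw [← h.adjoint_intertwine]; rfl
  have h₂ : ∀ i j, (adjoint (V i) ∘L X ∘L V j) * A = adjoint (V i) ∘L (X * π A) ∘L V j := by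
    intro i j
    calc _ = adjoint (V i) ∘L X ∘L (V j ∘L A) := rfl
      _ = _ := by rw [← h.intertwine]; rfl
  refine ⟨fun hX i j => by rw [h₁, h₂, hX], fun hX => h.ext_slices fun i j => ?_⟩
  rw [← h₁, ← h₂, hX]

/-- If `X` commutes with `π '' S`, all its slices lie in `S'`, hence commute with every element of
`S''`. This allows a von Neumann algebra and its generators to be interchanged inside a commutant.
-/
theorem centralizer_image_bicommutant (h : Amplification π V) (S : Set (H →L[ℂ] H)) :
    Set.centralizer (π '' Set.centralizer (Set.centralizer S)) = Set.centralizer (π '' S) := by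
  refine (Set.centralizer_subset (Set.image_mono Set.subset_centralizer_centralizer)).antisymm ?_
  rintro X hX _ ⟨A, hA, rfl⟩
  refine (h.commute_iff X A).2 fun i j => (hA _ fun B hB => ?_).symm
  exact (h.commute_iff X B).1 (hX _ ⟨B, hB, rfl⟩) i j

theorem map_mul (h : Amplification π V) (A B : H →L[ℂ] H) : π (A * B) = π A * π B := by
  refine h.ext _ _ fun i => ?_
  calc _ = (V i ∘L A) ∘L B := h.intertwine _ _
    _ = π A ∘L (V i ∘L B) := by rw [← h.intertwine]; rfl
    _ = _ := by rw [← h.intertwine]; rfl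

theorem injective (h : Amplification π V) : Function.Injective π := by
  obtain ⟨o, ho⟩ := h.exists_isometry
  have key : ∀ A, adjoint (V o) ∘L π A ∘L V o = A := fun A => by
    rw [h.intertwine, ← comp_assoc, ho]; rfl
  intro A B hAB
  rw [← key A, hAB, key]

/-- The operators `V i ∘L adjoint (V o)`, which play the role of `1 ⊗ |kᵢ)(kₒ|`, commute with the
range of `π`. An element `Y` of the bicommutant commutes with them, which forces `Y` to be the
amplification of its own compression by `V o`. -/
theorem bicommutant_image (h : Amplification π V) (S : Set (H →L[ℂ] H)) :
    Set.centralizer (Set.centralizer (π '' S)) =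
      π '' Set.centralizer (Set.centralizer S) := by
  apply Set.Subset.antisymm
  · intro Y hY
    obtain ⟨o, ho⟩ := h.exists_isometry
    have hcomm : ∀ i, (V i ∘L adjoint (V o)) ∘L Y = Y ∘L V i ∘L adjoint (V o) := by
      intro i
      refine hY _ ?_
      rintro _ ⟨A, -, rfl⟩
      calc _ = (π A ∘L V i) ∘L adjoint (V o) := rfl
        _ = V i ∘L (A ∘L adjoint (V o)) := by rw [h.intertwine]; rfl
        _ = _ := by rw [← h.adjoint_intertwine]; rfl
    have hπ : π (adjoint (V o) ∘L Y ∘L V o) = Y := by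
      refine h.ext _ _ fun i => ?_
      calc _ = ((V i ∘L adjoint (V o)) ∘L Y) ∘L V o := h.intertwine _ _
        _ = (Y ∘L V i) ∘L (adjoint (V o) ∘L V o) := by rw [hcomm]; rfl
        _ = _ := by rw [ho]; rfl
    -- For `B` in `S'`, `π B` commutes with `π '' S` and therefore with `Y`; injectivity of `π`
    -- transfers this to the compression, which thus lies in `S''`.
    refine ⟨_, fun B hB => ?_, hπ⟩
    apply h.injective
    rw [h.map_mul, h.map_mul, hπ]
    refine hY _ ?_
    rintro _ ⟨A, hA, rfl⟩
    rw [← h.map_mul, ← h.map_mul, hB A hA]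
  · rw [← h.centralizer_image_bicommutant]
    exact Set.subset_centralizer_centralizer

end Amplification

end Amplification

/-! ### Operators on the Hilbert space tensor product. -/

section OpTensor

variable {H K : Type*} [NormedAddCommGroup H] [InnerProductSpace ℂ H]
  [NormedAddCommGroup K] [InnerProductSpace ℂ K]

/-- The vector `h ⊗ k` in the Hilbert space tensor product. -/
noncomputable def htmul : H →L[ℂ] K →L[ℂ] HTensor H K :=
  (ContinuousLinearMap.compL ℂ K (H ⊗[ℂ] K) (HTensor H K) Completion.toComplL) ∘L
    TensorProduct.mkL ℂ H K

theorem htmul_apply (h : H) (k : K) : htmul h k = ((h ⊗ₜ[ℂ] k : H ⊗[ℂ] K) : HTensor H K) := rfl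

theorem opTensor_htmul (A : H →L[ℂ] H) (B : K →L[ℂ] K) (h : H) (k : K) :
    opTensor A B (htmul h k) = htmul (A h) (B k) := opTensor_tmul A B h k

theorem inner_htmul (h h' : H) (k k' : K) :
    ⟪htmul h k, htmul h' k'⟫_ℂ = ⟪h, h'⟫_ℂ * ⟪k, k'⟫_ℂ := by
  rw [htmul_apply, htmul_apply, Completion.inner_coe, TensorProduct.inner_tmul]

theorem ext_htmul {G : Type*} [NormedAddCommGroup G] [NormedSpace ℂ G]
    {X Y : HTensor H K →L[ℂ] G}
    (hXY : ∀ h k, X (htmul h k) = Y (htmul h k)) : X = Y := by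
  ext z
  refine Completion.induction_on z (isClosed_eq X.continuous Y.continuous) fun z => ?_
  induction z using TensorProduct.induction_on with
  | zero => rw [Completion.coe_zero, map_zero, map_zero]
  | add x y hx hy => rw [Completion.coe_add, map_add, map_add, hx, hy]
  | tmul h k => exact hXY h k

theorem opTensor_mul (A A' : H →L[ℂ] H) (B B' : K →L[ℂ] K) :
    opTensor A B * opTensor A' B' = opTensor (A * A') (B * B') :=
  ext_htmul fun h k => by
    simp only [mul_apply_eq_comp, opTensor_htmul]

theorem opTensor_one : opTensor (1 : H →L[ℂ] H) (1 : K →L[ℂ] K) = 1 :=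
  ext_htmul fun h k => by simp [opTensor_htmul]

theorem opTensor_add_left (A A' : H →L[ℂ] H) (B : K →L[ℂ] K) :
    opTensor (A + A') B = opTensor A B + opTensor A' B :=
  ext_htmul fun h k => by simp [opTensor_htmul]

theorem opTensor_add_right (A : H →L[ℂ] H) (B B' : K →L[ℂ] K) :
    opTensor A (B + B') = opTensor A B + opTensor A B' :=
  ext_htmul fun h k => by simp [opTensor_htmul]

theorem opTensor_smul_left (c : ℂ) (A : H →L[ℂ] H) (B : K →L[ℂ] K) :
    opTensor (c • A) B = c • opTensor A B :=
  ext_htmul fun h k => by simp [opTensor_htmul]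

theorem opTensor_neg_left (A : H →L[ℂ] H) (B : K →L[ℂ] K) :
    opTensor (-A) B = -opTensor A B :=
  ext_htmul fun h k => by simp [opTensor_htmul]

theorem opTensor_neg_right (A : H →L[ℂ] H) (B : K →L[ℂ] K) :
    opTensor A (-B) = -opTensor A B :=
  ext_htmul fun h k => by simp [opTensor_htmul]

open ContinuousLinearMap in
theorem adjoint_opTensor [CompleteSpace H] [CompleteSpace K] (A : H →L[ℂ] H) (B : K →L[ℂ] K) :
    adjoint (opTensor A B) = opTensor (adjoint A) (adjoint B) := by
  -- Product vectors are total. Passing to the functionals `innerSL ℂ x` makes this an instance of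
  -- `ext_htmul`.
  have h0 : ∀ (x y : HTensor H K), (∀ h k, ⟪htmul h k, x⟫_ℂ = ⟪htmul h k, y⟫_ℂ) → x = y := by
    intro x y hxy
    have : innerSL ℂ x = innerSL ℂ y := ext_htmul fun h k => by
      rw [innerSL_apply_apply, innerSL_apply_apply, ← inner_conj_symm, hxy, inner_conj_symm]
    exact ext_inner_right ℂ fun v => by
      simpa using DFunLike.congr_fun this v
  refine ext_htmul fun h k => h0 _ _ fun h' k' => ?_
  rw [adjoint_inner_right, opTensor_htmul, opTensor_htmul, inner_htmul, inner_htmul,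
    adjoint_inner_right, adjoint_inner_right]

open ContinuousLinearMap in
-- The intertwiners are `h ↦ h ⊗ k`; any unit vector `k` yields the required isometry.
theorem amplification_left [CompleteSpace H] [CompleteSpace K] [Nontrivial K] :
    Amplification (fun A : H →L[ℂ] H => (opTensor A 1 : HTensor H K →L[ℂ] HTensor H K))
      (fun k : K => htmul.flip k) where
  intertwine A k := by
    ext h
    simp [opTensor_htmul]
  map_adjoint A := by
    change adjoint (opTensor A 1) = opTensor (adjoint A) 1
    rw [adjoint_opTensor, adjoint_one]
  ext X Y hXY := ext_htmul fun h k => DFunLike.congr_fun (hXY k) h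
  exists_isometry := by
    obtain ⟨k, hk⟩ := exists_norm_eq K zero_le_one
    refine ⟨k, ?_⟩
    ext1 h
    refine ext_inner_left ℂ fun h' => ?_
    rw [comp_apply, adjoint_inner_right, flip_apply, flip_apply, inner_htmul,
      inner_self_eq_norm_sq_to_K, hk]
    simp

open ContinuousLinearMap in
theorem amplification_right [CompleteSpace H] [CompleteSpace K] [Nontrivial H] :
    Amplification (fun B : K →L[ℂ] K => (opTensor 1 B : HTensor H K →L[ℂ] HTensor H K))
      (fun h : H => htmul h) where
  intertwine A k := by
    ext h
    simp [opTensor_htmul]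
  map_adjoint A := by
    change adjoint (opTensor 1 A) = opTensor 1 (adjoint A)
    rw [adjoint_opTensor, adjoint_one]
  ext X Y hXY := ext_htmul fun h k => DFunLike.congr_fun (hXY h) k
  exists_isometry := by
    obtain ⟨k, hk⟩ := exists_norm_eq H zero_le_one
    refine ⟨k, ?_⟩
    ext1 h
    refine ext_inner_left ℂ fun h' => ?_
    rw [comp_apply, adjoint_inner_right, inner_htmul,
      inner_self_eq_norm_sq_to_K, hk]
    simp

end OpTensor

/-! ### Conjugation by a unitary operator. -/

section Conjugation

variable {H G : Type*} [NormedAddCommGroup H] [InnerProductSpace ℂ H] [CompleteSpace H]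
  [NormedAddCommGroup G] [InnerProductSpace ℂ G] [CompleteSpace G]

theorem conj_eq_of_intertwine (e : H ≃ₗᵢ[ℂ] G) {X : H →L[ℂ] H} {Y : G →L[ℂ] G}
    (h : (e : H →L[ℂ] G) ∘L X = Y ∘L (e : H →L[ℂ] G)) : e.conjStarAlgEquiv X = Y := by
  ext1 x
  rw [LinearIsometryEquiv.conjStarAlgEquiv_apply_apply]
  simpa using DFunLike.congr_fun h (e.symm x)

theorem conj_add (e : H ≃ₗᵢ[ℂ] G) (X Y : H →L[ℂ] H) :
    e.conjStarAlgEquiv (X + Y) = e.conjStarAlgEquiv X + e.conjStarAlgEquiv Y :=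
  map_add _ _ _

theorem conj_mul (e : H ≃ₗᵢ[ℂ] G) (X Y : H →L[ℂ] H) :
    e.conjStarAlgEquiv (X * Y) = e.conjStarAlgEquiv X * e.conjStarAlgEquiv Y :=
  map_mul _ _ _

theorem conj_adjoint (e : H ≃ₗᵢ[ℂ] G) (X : H →L[ℂ] H) :
    e.conjStarAlgEquiv (ContinuousLinearMap.adjoint X) =
      ContinuousLinearMap.adjoint (e.conjStarAlgEquiv X) :=
  map_star e.conjStarAlgEquiv X

theorem conj_image_centralizer (e : H ≃ₗᵢ[ℂ] G) (S : Set (H →L[ℂ] H)) :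
    e.conjStarAlgEquiv '' Set.centralizer S = Set.centralizer (e.conjStarAlgEquiv '' S) :=
  image_centralizer (e.conjStarAlgEquiv : (H →L[ℂ] H) ≃* (G →L[ℂ] G)) S

end Conjugation

/-! ### Functions of the number operator, and irreducibility on Fock space. -/

section FockOperators

open ContinuousLinearMap

variable {Z : Type*} [NormedAddCommGroup Z] [InnerProductSpace ℂ Z]

theorem ext_fock {G : Type*} [NormedAddCommGroup G] [NormedSpace ℂ G] {X Y : Fock Z →L[ℂ] G}
    (h : ∀ Ψ : ExteriorAlgebra ℂ Z, X (Ψ : Fock Z) = Y (Ψ : Fock Z)) : X = Y := by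
  ext z
  exact Completion.induction_on z (isClosed_eq X.continuous Y.continuous) h

theorem fock_eq_of_inner {x y : Fock Z}
    (h : ∀ Ψ : ExteriorAlgebra ℂ Z, ⟪(Ψ : Fock Z), x⟫_ℂ = ⟪(Ψ : Fock Z), y⟫_ℂ) : x = y := by
  refine ext_inner_left ℂ fun v => ?_
  refine Completion.induction_on v (isClosed_eq ?_ ?_) h <;> fun_prop

theorem creation_coe (w : Z) (Ψ : ExteriorAlgebra ℂ Z) :
    creation w (Ψ : Fock Z) = ((ExteriorAlgebra.ι ℂ w * Ψ : ExteriorAlgebra ℂ Z) : Fock Z) := by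
  rw [creation, completion_apply_coe]
  rfl

theorem annihilation_coe (w : Z) (Ψ : ExteriorAlgebra ℂ Z) :
    annihilation w (Ψ : Fock Z) = ((contr w Ψ : ExteriorAlgebra ℂ Z) : Fock Z) := by
  refine fock_eq_of_inner fun Φ => ?_
  rw [annihilation, adjoint_inner_right, creation_coe, Completion.inner_coe, Completion.inner_coe,
    inner_eq_form, inner_eq_form, form_ι_mul_left]

theorem numSign_coe (s : ℕ → ℤˣ) (Ψ : ExteriorAlgebra ℂ Z) :
    numSign s (Ψ : Fock Z) = ((numSignFin s Ψ : ExteriorAlgebra ℂ Z) : Fock Z) := by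
  rw [numSign, completion_apply_coe]
  rfl

theorem numSignFin_numSignFin (s t : ℕ → ℤˣ) (Ψ : ExteriorAlgebra ℂ Z) :
    numSignFin s (numSignFin t Ψ) = numSignFin (s * t) Ψ := by
  induction Ψ using ext_induction generalizing s t with
  | one => simp [numSignFin_one, smul_smul, mul_comm]
  | smul c x h => simp [h]
  | add x y hx hy => simp [hx, hy]
  | ι_mul x m h =>
    rw [numSignFin_ι_mul, numSignFin_ι_mul, numSignFin_ι_mul, h]
    rfl

theorem numSignFin_one_fun (Ψ : ExteriorAlgebra ℂ Z) : numSignFin 1 Ψ = Ψ := by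
  induction Ψ using ext_induction with
  | one => simp [numSignFin_one]
  | smul c x h => simp [h]
  | add x y hx hy => simp [hx, hy]
  | ι_mul x m h =>
    rw [numSignFin_ι_mul]
    exact congrArg _ h

theorem numSign_mul (s t : ℕ → ℤˣ) :
    (numSign s * numSign t : Fock Z →L[ℂ] Fock Z) = numSign (s * t) :=
  ext_fock fun Ψ => by
    rw [mul_apply_eq_comp, numSign_coe, numSign_coe, numSign_coe, numSignFin_numSignFin]

theorem numSign_mul_self (s : ℕ → ℤˣ) : (numSign s * numSign s : Fock Z →L[ℂ] Fock Z) = 1 := by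
  rw [numSign_mul, show s * s = 1 from funext fun n => Int.units_mul_self (s n)]
  exact ext_fock fun Ψ => by rw [numSign_coe, numSignFin_one_fun]; rfl

theorem numSign_comm (s t : ℕ → ℤˣ) :
    (numSign s * numSign t : Fock Z →L[ℂ] Fock Z) = numSign t * numSign s := by
  rw [numSign_mul, numSign_mul, mul_comm]

/-- An isometric involution is self-adjoint. -/
theorem adjoint_numSign (s : ℕ → ℤˣ) :
    adjoint (numSign s : Fock Z →L[ℂ] Fock Z) = numSign s := by
  refine ext_fock fun Ψ => fock_eq_of_inner fun Φ => ?_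
  have h : numSignFin s (numSignFin s Ψ) = Ψ := by
    rw [numSignFin_numSignFin, show s * s = 1 from funext fun n => Int.units_mul_self (s n),
      numSignFin_one_fun]
  rw [adjoint_inner_right, numSign_coe, numSign_coe, Completion.inner_coe, Completion.inner_coe,
    inner_eq_form, inner_eq_form, ← form_numSignFin s Φ, h]

theorem parity_mul_self : parity Z * parity Z = 1 := numSign_mul_self _

theorem Lam_mul_self : Lam Z * Lam Z = 1 := numSign_mul_self _

theorem parity_mul_Lam : parity Z * Lam Z = Lam Z * parity Z := numSign_comm _ _

theorem adjoint_parity : adjoint (parity Z) = parity Z := adjoint_numSign _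

theorem numSignFin_neg (s : ℕ → ℤˣ) (Ψ : ExteriorAlgebra ℂ Z) :
    numSignFin (-s) Ψ = -numSignFin s Ψ := by
  induction Ψ using ext_induction generalizing s with
  | one => simp [numSignFin_one]
  | smul c x h => simp [h]
  | add x y hx hy => simp [hx, hy, add_comm]
  | ι_mul x m h =>
    rw [numSignFin_ι_mul, numSignFin_ι_mul, ← mul_neg, ← h]
    rfl

theorem parity_mul_creation (w : Z) : parity Z * creation w = -(creation w * parity Z) := by
  refine ext_fock fun Ψ => ?_
  have h : (fun n : ℕ => (-1 : ℤˣ) ^ (n + 1)) = -(fun n : ℕ => (-1 : ℤˣ) ^ n) := by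
    ext n
    simp [pow_succ]
  rw [parity, neg_apply, mul_apply_eq_comp, mul_apply_eq_comp, creation_coe, numSign_coe,
    numSign_coe, creation_coe, numSignFin_ι_mul, h, numSignFin_neg, mul_neg, Completion.coe_neg]

theorem parity_mul_annihilation (w : Z) :
    parity Z * annihilation w = -(annihilation w * parity Z) := by
  have h := congrArg adjoint (parity_mul_creation w)
  rw [map_neg] at h
  change adjoint (parity Z ∘L creation w) = -adjoint (creation w ∘L parity Z) at h
  rw [adjoint_comp, adjoint_comp, adjoint_parity] at h
  change annihilation w * parity Z = -(parity Z * annihilation w) at h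
  rw [h, neg_neg]

theorem parity_mul_field (w : Z) : parity Z * field w = -(field w * parity Z) := by
  rw [field, mul_add, add_mul, parity_mul_creation, parity_mul_annihilation, neg_add]

theorem creation_smul (c : ℂ) (w : Z) : creation (c • w) = c • creation w :=
  ext_fock fun Ψ => by simp [creation_coe, Completion.coe_smul]

theorem creation_zero : creation (0 : Z) = 0 := by
  simpa using creation_smul 0 (0 : Z)

theorem field_zero : field (0 : Z) = 0 := by
  rw [field, annihilation, creation_zero, map_zero, add_zero]

theorem field_I_smul (w : Z) :
    field (Complex.I • w) = Complex.I • (creation w - annihilation w) := by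
  rw [field, annihilation, creation_smul, map_smulₛₗ, annihilation, smul_sub, Complex.conj_I,
    neg_smul, sub_eq_add_neg]

/-- Since `a*` is linear and `a` antilinear, the fields at `w` and `i w` separate the two. Hence
commuting with all fields means commuting with all creation and annihilation operators. -/
theorem creation_eq_field (w : Z) :
    creation w = (1 / 2 : ℂ) • (field w - Complex.I • field (Complex.I • w)) := by
  rw [field_I_smul, smul_smul, Complex.I_mul_I, field]
  module

theorem annihilation_eq_field (w : Z) :
    annihilation w = (1 / 2 : ℂ) • (field w + Complex.I • field (Complex.I • w)) := by
  rw [field_I_smul, smul_smul, Complex.I_mul_I, field]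
  module

variable (Z) in
/-- The vacuum vector. -/
noncomputable def vacuum : Fock Z := ((1 : ExteriorAlgebra ℂ Z) : Fock Z)

theorem inner_vacuum : ⟪vacuum Z, vacuum Z⟫_ℂ = 1 := by
  rw [vacuum, Completion.inner_coe, inner_eq_form, form_one_right, map_one, map_one]

instance : Nontrivial (Fock Z) :=
  ⟨vacuum Z, 0, fun h => by simpa [h] using inner_vacuum (Z := Z)⟩

/-- Irreducibility of the Fock representation. -/
theorem exists_eq_smul_one_of_mem_centralizer {X : Fock Z →L[ℂ] Fock Z}
    (hX : X ∈ Set.centralizer (field '' (Set.univ : Set Z))) : ∃ c : ℂ, X = c • 1 := by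
  have hf : ∀ w, field w * X = X * field w := fun w => hX _ ⟨w, trivial, rfl⟩
  have hc : ∀ w, creation w * X = X * creation w := fun w => by
    rw [creation_eq_field]
    simp only [smul_mul_assoc, mul_smul_comm, sub_mul, mul_sub, hf]
  have ha : ∀ w, annihilation w * X = X * annihilation w := fun w => by
    rw [annihilation_eq_field]
    simp only [smul_mul_assoc, mul_smul_comm, add_mul, mul_add, hf]
  have hv : ∀ w, annihilation w (vacuum Z) = 0 := fun w => by
    rw [vacuum, annihilation_coe, contr_one, Completion.coe_zero]
  have hav : ∀ w, annihilation w (X (vacuum Z)) = 0 := fun w => by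
    rw [← mul_apply_eq_comp, ha, mul_apply_eq_comp, hv, map_zero]
  set c := ⟪vacuum Z, X (vacuum Z)⟫_ℂ with hcdef
  -- Every `a(w)` annihilates `X (vacuum Z)`, so this vector is orthogonal to all products `w ∧ x`;
  -- only its vacuum component survives.
  have hXv : X (vacuum Z) = c • vacuum Z := by
    refine fock_eq_of_inner fun Φ => ?_
    induction Φ using ext_induction with
    | one =>
      change ⟪vacuum Z, _⟫_ℂ = ⟪vacuum Z, _⟫_ℂ
      rw [inner_smul_right, inner_vacuum, mul_one]
    | smul a x h => rw [Completion.coe_smul, inner_smul_left, inner_smul_left, h]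
    | add x y hx hy => rw [Completion.coe_add, inner_add_left, inner_add_left, hx, hy]
    | ι_mul x w h =>
      rw [← creation_coe, ← adjoint_inner_right, ← adjoint_inner_right]
      change ⟪_, annihilation w _⟫_ℂ = ⟪_, annihilation w _⟫_ℂ
      rw [hav, map_smul, hv, smul_zero]
  -- The vacuum is cyclic for the creation operators, and `X` commutes with these.
  refine ⟨c, ext_fock fun Ψ => ?_⟩
  induction Ψ using ext_induction with
  | one => exact hXv
  | smul a x h => rw [Completion.coe_smul, map_smul, map_smul, h]
  | add x y hx hy => rw [Completion.coe_add, map_add, map_add, hx, hy]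
  | ι_mul x w h =>
    rw [← creation_coe, ← mul_apply_eq_comp, ← hc, mul_apply_eq_comp, h]
    simp

theorem fieldAlgebra_top : fieldAlgebra (⊤ : Submodule ℝ Z) = Set.univ := by
  refine Set.eq_univ_of_forall fun A X hX => ?_
  obtain ⟨c, hc⟩ := exists_eq_smul_one_of_mem_centralizer (X := X) (by simpa using hX)
  rw [hc, smul_one_mul, mul_smul_one]

end FockOperators

/-! ### Fields, twist and `Λ` under the exponential law. -/

section ExponentialOperators

open ContinuousLinearMap

variable {W₁ W₂ : Type*} [NormedAddCommGroup W₁] [InnerProductSpace ℂ W₁]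
  [NormedAddCommGroup W₂] [InnerProductSpace ℂ W₂]

theorem ext_htmul_coe {G : Type*} [NormedAddCommGroup G] [NormedSpace ℂ G]
    {X Y : HTensor (Fock W₁) (Fock W₂) →L[ℂ] G}
    (h : ∀ (Ψ₁ : ExteriorAlgebra ℂ W₁) (Ψ₂ : ExteriorAlgebra ℂ W₂),
      X (htmul (Ψ₁ : Fock W₁) (Ψ₂ : Fock W₂)) = Y (htmul (Ψ₁ : Fock W₁) (Ψ₂ : Fock W₂))) :
    X = Y := by
  have : (compL ℂ (Fock W₂) _ G X) ∘L htmul = (compL ℂ (Fock W₂) _ G Y) ∘L htmul :=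
    ext_fock fun Ψ₁ => ext_fock fun Ψ₂ => h Ψ₁ Ψ₂
  exact ext_htmul fun x y => DFunLike.congr_fun (DFunLike.congr_fun this x) y

/-- The `n`-particle vector `v₁ ∧ ⋯ ∧ vₙ`. -/
noncomputable def wedge {Z : Type*} [NormedAddCommGroup Z] [InnerProductSpace ℂ Z] (n : ℕ)
    (v : Fin n → Z) : Fock Z :=
  ((ExteriorAlgebra.ιMulti ℂ n v : ExteriorAlgebra ℂ Z) : Fock Z)

theorem ext_htmul_wedge {G : Type*} [NormedAddCommGroup G] [NormedSpace ℂ G]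
    {X Y : HTensor (Fock W₁) (Fock W₂) →L[ℂ] G}
    (h : ∀ (n m : ℕ) (v : Fin n → W₁) (w : Fin m → W₂),
      X (htmul (wedge n v) (wedge m w)) = Y (htmul (wedge n v) (wedge m w))) : X = Y := by
  refine ext_htmul_coe fun Ψ₁ Ψ₂ => ?_
  have h₁ : Ψ₁ ∈ Submodule.span ℂ
      (Set.range fun x : Σ n, (Fin n → W₁) => ExteriorAlgebra.ιMulti ℂ x.1 x.2) := by
    rw [ExteriorAlgebra.ιMulti_span]; trivial
  have h₂ : Ψ₂ ∈ Submodule.span ℂ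
      (Set.range fun x : Σ n, (Fin n → W₂) => ExteriorAlgebra.ιMulti ℂ x.1 x.2) := by
    rw [ExteriorAlgebra.ιMulti_span]; trivial
  induction h₁ using Submodule.span_induction with
  | zero => simp only [Completion.coe_zero, map_zero, zero_apply]
  | add x y _ _ hx hy => simp only [Completion.coe_add, map_add, add_apply, hx, hy]
  | smul c x _ hx => simp only [Completion.coe_smul, map_smul, smul_apply, hx]
  | mem x hx =>
    obtain ⟨⟨n, v⟩, rfl⟩ := hx
    induction h₂ using Submodule.span_induction with
    | zero => simp only [Completion.coe_zero, map_zero]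
    | add x y _ _ hx hy => simp only [Completion.coe_add, map_add, hx, hy]
    | smul c x _ hx => simp only [Completion.coe_smul, map_smul, hx]
    | mem y hy =>
      obtain ⟨⟨m, w⟩, rfl⟩ := hy
      exact h n m v w

/-- Each of the `n` anticommutations with a factor from `W₁` contributes a sign. This is the source
of the parity operator in `conj_expLaw_creation`. -/
theorem ι_inr_mul_map_inl_eq (w : W₂) (Ψ : ExteriorAlgebra ℂ W₁) :
    ExteriorAlgebra.ι ℂ (inrH W₁ W₂ w) * ExteriorAlgebra.map (inlH W₁ W₂) Ψ =
      ExteriorAlgebra.map (inlH W₁ W₂) (numSignFin (fun n => (-1) ^ n) Ψ) *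
        ExteriorAlgebra.ι ℂ (inrH W₁ W₂ w) := by
  have h : (fun n : ℕ => (-1 : ℤˣ) ^ (n + 1)) = -(fun n : ℕ => (-1 : ℤˣ) ^ n) := by
    ext n
    simp [pow_succ]
  induction Ψ using ext_induction with
  | one => simp [numSignFin_one]
  | smul c x h => simp [h]
  | add x y hx hy => simp [mul_add, add_mul, hx, hy]
  | ι_mul x m ih =>
    rw [map_mul, ExteriorAlgebra.map_apply_ι, ι_mul_ι_mul, ih, numSignFin_ι_mul, h,
      numSignFin_neg, mul_neg, map_neg, map_mul, ExteriorAlgebra.map_apply_ι, neg_mul, mul_assoc]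

theorem inlH_add_inrH (w : WithLp 2 (W₁ × W₂)) :
    inlH W₁ W₂ w.fst + inrH W₁ W₂ w.snd = w := by
  apply WithLp.ofLp_injective
  ext <;> simp [inlH, inrH]

theorem expLaw_htmul (Ψ₁ : ExteriorAlgebra ℂ W₁) (Ψ₂ : ExteriorAlgebra ℂ W₂) :
    expLaw W₁ W₂ (htmul (Ψ₁ : Fock W₁) (Ψ₂ : Fock W₂)) =
      ((ExteriorAlgebra.map (inlH W₁ W₂) Ψ₁ * ExteriorAlgebra.map (inrH W₁ W₂) Ψ₂ :
        ExteriorAlgebra ℂ (WithLp 2 (W₁ × W₂))) : Fock (WithLp 2 (W₁ × W₂))) :=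
  expLaw_tmul W₁ W₂ Ψ₁ Ψ₂

theorem expLaw_creation_htmul (w : WithLp 2 (W₁ × W₂)) (Ψ₁ : ExteriorAlgebra ℂ W₁)
    (Ψ₂ : ExteriorAlgebra ℂ W₂) :
    expLaw W₁ W₂ (opTensor (creation w.fst) 1 (htmul (Ψ₁ : Fock W₁) (Ψ₂ : Fock W₂)) +
      opTensor (parity W₁) (creation w.snd) (htmul (Ψ₁ : Fock W₁) (Ψ₂ : Fock W₂))) =
    creation w (expLaw W₁ W₂ (htmul (Ψ₁ : Fock W₁) (Ψ₂ : Fock W₂))) := by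
  have h₃ : ExteriorAlgebra.ι ℂ w = ExteriorAlgebra.ι ℂ (inlH W₁ W₂ w.fst) +
      ExteriorAlgebra.ι ℂ (inrH W₁ W₂ w.snd) := by
    rw [← map_add, inlH_add_inrH]
  have h₁ : expLaw W₁ W₂ (opTensor (creation w.fst) 1 (htmul (Ψ₁ : Fock W₁) (Ψ₂ : Fock W₂))) =
      ((ExteriorAlgebra.ι ℂ (inlH W₁ W₂ w.fst) * (ExteriorAlgebra.map (inlH W₁ W₂) Ψ₁ *
        ExteriorAlgebra.map (inrH W₁ W₂) Ψ₂) : ExteriorAlgebra ℂ (WithLp 2 (W₁ × W₂))) :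
          Fock (WithLp 2 (W₁ × W₂))) := by
    rw [opTensor_htmul, creation_coe, one_apply_eq_self, expLaw_htmul, map_mul,
      ExteriorAlgebra.map_apply_ι, mul_assoc]
  have h₂ : expLaw W₁ W₂ (opTensor (parity W₁) (creation w.snd)
        (htmul (Ψ₁ : Fock W₁) (Ψ₂ : Fock W₂))) =
      ((ExteriorAlgebra.ι ℂ (inrH W₁ W₂ w.snd) * (ExteriorAlgebra.map (inlH W₁ W₂) Ψ₁ *
        ExteriorAlgebra.map (inrH W₁ W₂) Ψ₂) : ExteriorAlgebra ℂ (WithLp 2 (W₁ × W₂))) :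
          Fock (WithLp 2 (W₁ × W₂))) := by
    rw [opTensor_htmul, creation_coe, parity, numSign_coe, expLaw_htmul, map_mul,
      ExteriorAlgebra.map_apply_ι, ← mul_assoc, ← ι_inr_mul_map_inl_eq, mul_assoc]
  calc _ = _ + _ := map_add (expLaw W₁ W₂) _ _
    _ = _ := congrArg₂ (· + ·) h₁ h₂
    _ = creation w _ := by rw [creation_coe, h₃, add_mul, Completion.coe_add]
    _ = _ := congrArg (creation w) (expLaw_htmul Ψ₁ Ψ₂).symm

theorem conj_expLaw_creation (w : WithLp 2 (W₁ × W₂)) :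
    (expLaw W₁ W₂).conjStarAlgEquiv
      (opTensor (creation w.fst) 1 + opTensor (parity W₁) (creation w.snd)) = creation w :=
  conj_eq_of_intertwine _ (ext_htmul_coe fun Ψ₁ Ψ₂ => expLaw_creation_htmul w Ψ₁ Ψ₂)

theorem conj_expLaw_field (w : WithLp 2 (W₁ × W₂)) :
    (expLaw W₁ W₂).conjStarAlgEquiv
      (opTensor (field w.fst) 1 + opTensor (parity W₁) (field w.snd)) = field w := by
  -- The annihilation part is the adjoint of the creation part because the parity is self-adjoint,
  -- and conjugation by a unitary respects adjoints.
  have hX : opTensor (field w.fst) 1 + opTensor (parity W₁) (field w.snd) =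
      (opTensor (creation w.fst) 1 + opTensor (parity W₁) (creation w.snd)) +
      adjoint (opTensor (creation w.fst) 1 + opTensor (parity W₁) (creation w.snd)) := by
    rw [map_add, adjoint_opTensor, adjoint_opTensor, adjoint_parity, adjoint_one, field, field,
      opTensor_add_left, opTensor_add_right, annihilation, annihilation]
    abel
  rw [hX, conj_add, conj_adjoint, conj_expLaw_creation]
  rfl

theorem numSignFin_ιMulti_mul {Z : Type*} [NormedAddCommGroup Z] [InnerProductSpace ℂ Z]
    (s : ℕ → ℤˣ) (n : ℕ) (v : Fin n → Z) (Ψ : ExteriorAlgebra ℂ Z) :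
    numSignFin s (ExteriorAlgebra.ιMulti ℂ n v * Ψ) =
      ExteriorAlgebra.ιMulti ℂ n v * numSignFin (fun k => s (k + n)) Ψ := by
  induction n generalizing s with
  | zero => simp
  | succ n ih =>
    rw [ExteriorAlgebra.ιMulti_succ_apply, mul_assoc, mul_assoc, numSignFin_ι_mul, ih]
    simp only [add_assoc]

theorem Lam_wedge {Z : Type*} [NormedAddCommGroup Z] [InnerProductSpace ℂ Z] (n : ℕ)
    (v : Fin n → Z) :
    Lam Z (wedge n v) = ((-1 : ℂ) ^ (n * (n - 1) / 2)) • wedge n v := by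
  rw [Lam, wedge, numSign_coe, numSignFin_ιMulti, Completion.coe_smul]
  simp

theorem twist_htmul_wedge (n m : ℕ) (v : Fin n → W₁) (w : Fin m → W₂) :
    twist W₁ W₂ (htmul (wedge n v) (wedge m w)) =
      ((-1 : ℂ) ^ (n * m)) • htmul (wedge n v) (wedge m w) :=
  twist_ιMulti W₁ W₂ n m v w

theorem opTensor_Lam_htmul_wedge (n m : ℕ) (v : Fin n → W₁) (w : Fin m → W₂) :
    opTensor (Lam W₁) (Lam W₂) (htmul (wedge n v) (wedge m w)) =
      ((-1 : ℂ) ^ (n * (n - 1) / 2 + m * (m - 1) / 2)) • htmul (wedge n v) (wedge m w) := by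
  rw [opTensor_htmul, Lam_wedge, Lam_wedge, map_smul, map_smul, smul_apply, smul_smul, pow_add,
    mul_comm]

/-- Pairs in a disjoint union of sets of sizes `n` and `m` lie in one set, in the other, or are
mixed; the mixed ones number `nm` and account for the twist in `conj_expLaw_Lam`. -/
theorem triangle_add (n m : ℕ) :
    (m + n) * (m + n - 1) / 2 = n * m + n * (n - 1) / 2 + m * (m - 1) / 2 := by
  have h : ∀ n : ℕ, n * (n - 1) / 2 = n.choose 2 := fun n => (Nat.choose_two_right n).symm
  rw [h, h, h]
  induction m with
  | zero => simp
  | succ m ih =>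
    rw [show m + 1 + n = (m + n) + 1 by ring, Nat.choose_succ_succ' (m + n) 1,
      Nat.choose_succ_succ' m 1, ih]
    simp only [Nat.choose_one_right]
    ring

theorem twist_mul_self : twist W₁ W₂ * twist W₁ W₂ = 1 :=
  ext_htmul_wedge fun n m v w => by
    rw [mul_apply_eq_comp, twist_htmul_wedge, map_smul, twist_htmul_wedge, smul_smul, ← mul_pow,
      neg_one_mul, neg_neg, one_pow, one_smul, one_apply_eq_self]

theorem twist_mul_Lam : twist W₁ W₂ * opTensor (Lam W₁) (Lam W₂) =
    opTensor (Lam W₁) (Lam W₂) * twist W₁ W₂ :=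
  ext_htmul_wedge fun n m v w => by
    rw [mul_apply_eq_comp, mul_apply_eq_comp, twist_htmul_wedge, opTensor_Lam_htmul_wedge,
      map_smul, map_smul, twist_htmul_wedge, opTensor_Lam_htmul_wedge, smul_comm]

theorem Lam_expLaw_htmul_wedge (n m : ℕ) (v : Fin n → W₁) (w : Fin m → W₂) :
    Lam (WithLp 2 (W₁ × W₂)) (expLaw W₁ W₂ (htmul (wedge n v) (wedge m w))) =
      ((-1 : ℂ) ^ ((m + n) * (m + n - 1) / 2)) •
        expLaw W₁ W₂ (htmul (wedge n v) (wedge m w)) := by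
  rw [wedge, wedge, expLaw_htmul, ExteriorAlgebra.map_apply_ιMulti,
    ExteriorAlgebra.map_apply_ιMulti, Lam, numSign_coe, numSignFin_ιMulti_mul, numSignFin_ιMulti,
    mul_smul_comm, Completion.coe_smul]
  simp

theorem conj_expLaw_Lam :
    (expLaw W₁ W₂).conjStarAlgEquiv (twist W₁ W₂ * opTensor (Lam W₁) (Lam W₂)) =
      Lam (WithLp 2 (W₁ × W₂)) := by
  refine conj_eq_of_intertwine _ (ext_htmul_wedge fun n m v w => ?_)
  have h : (twist W₁ W₂ * opTensor (Lam W₁) (Lam W₂)) (htmul (wedge n v) (wedge m w)) =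
      ((-1 : ℂ) ^ ((m + n) * (m + n - 1) / 2)) • htmul (wedge n v) (wedge m w) := by
    rw [mul_apply_eq_comp, opTensor_Lam_htmul_wedge, map_smul, twist_htmul_wedge, smul_smul,
      ← pow_add, triangle_add]
    congr 2
    ring
  change expLaw W₁ W₂ ((twist W₁ W₂ * opTensor (Lam W₁) (Lam W₂)) (htmul _ _)) =
    Lam _ (expLaw W₁ W₂ (htmul _ _))
  rw [h, Lam_expLaw_htmul_wedge]
  exact map_smul _ _ _

theorem opTensor_sub_left {H K : Type*} [NormedAddCommGroup H] [InnerProductSpace ℂ H]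
    [NormedAddCommGroup K] [InnerProductSpace ℂ K] (A A' : H →L[ℂ] H) (B : K →L[ℂ] K) :
    opTensor (A - A') B = opTensor A B - opTensor A' B :=
  ext_htmul fun h k => by simp [opTensor_htmul]

/-- On the odd part of the first factor the twist acts as `(-1)^N₂`, and moving this past the odd
operator `B` gives a minus sign. On the even part there is none; together the signs form `(-1)^N₁`.
-/
theorem twist_conj_right {B : Fock W₂ →L[ℂ] Fock W₂} (hB : parity W₂ * B = -(B * parity W₂)) :
    twist W₁ W₂ * opTensor 1 B * twist W₁ W₂ = opTensor (parity W₁) B := by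
  have h : twist W₁ W₂ * opTensor 1 B = opTensor (parity W₁) B * twist W₁ W₂ := by
    simp only [twist, add_mul, mul_add, opTensor_mul, opTensor_smul_left, smul_mul_assoc,
      mul_smul_comm, mul_one, one_mul, mul_sub, sub_mul, opTensor_add_left, opTensor_sub_left,
      parity_mul_self, hB, opTensor_neg_right]
    module
  rw [h, mul_assoc, twist_mul_self, mul_one]

theorem twist_conj_left {A : Fock W₁ →L[ℂ] Fock W₁} (hA : parity W₁ * A = -(A * parity W₁)) :
    twist W₁ W₂ * opTensor A 1 * twist W₁ W₂ = opTensor A (parity W₂) := by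
  have h : twist W₁ W₂ * opTensor A 1 = opTensor A (parity W₂) * twist W₁ W₂ := by
    simp only [twist, add_mul, mul_add, opTensor_mul, opTensor_smul_left, smul_mul_assoc,
      mul_smul_comm, mul_one, one_mul, mul_sub, sub_mul, opTensor_add_left, opTensor_sub_left,
      parity_mul_self, hA, opTensor_neg_left]
    module
  rw [h, mul_assoc, twist_mul_self, mul_one]

end ExponentialOperators

/-! ### From generators to the von Neumann algebras. -/

section Bicommutants

section General

variable {H K : Type*} [NormedAddCommGroup H] [InnerProductSpace ℂ H]
  [NormedAddCommGroup K] [InnerProductSpace ℂ K]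

theorem centralizer_eq_univ_of_forall_eq_zero {R : Type*} [Ring R] {S : Set R}
    (h : ∀ A ∈ S, A = 0) : Set.centralizer S = Set.univ :=
  Set.eq_univ_of_forall fun X A hA => by rw [h A hA, zero_mul, mul_zero]

theorem zero_opTensor (B : K →L[ℂ] K) : opTensor (0 : H →L[ℂ] H) B = 0 :=
  ext_htmul fun h k => by simp [opTensor_htmul]

theorem opTensor_zero (A : H →L[ℂ] H) : opTensor A (0 : K →L[ℂ] K) = 0 :=
  ext_htmul fun h k => by simp [opTensor_htmul]

theorem opTensor_eq_mul (A : H →L[ℂ] H) (B : K →L[ℂ] K) :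
    opTensor A B = opTensor A 1 * opTensor 1 B := by
  rw [opTensor_mul, mul_one, one_mul]

theorem opTensor_eq_mul' (A : H →L[ℂ] H) (B : K →L[ℂ] K) :
    opTensor A B = opTensor 1 B * opTensor A 1 := by
  rw [opTensor_mul, mul_one, one_mul]

theorem centralizer_image2_opTensor {M : Set (H →L[ℂ] H)} {N : Set (K →L[ℂ] K)}
    (hM : 1 ∈ M) (hN : 1 ∈ N) :
    Set.centralizer (Set.image2 opTensor M N) =
      Set.centralizer ((fun A => opTensor A 1) '' M) ∩
        Set.centralizer ((fun B => opTensor 1 B) '' N) := by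
  apply Set.Subset.antisymm
  · refine Set.subset_inter (Set.centralizer_subset ?_) (Set.centralizer_subset ?_)
    · rintro _ ⟨A, hA, rfl⟩
      exact ⟨A, hA, 1, hN, rfl⟩
    · rintro _ ⟨B, hB, rfl⟩
      exact ⟨1, hM, B, hB, rfl⟩
  · rintro X ⟨h₁, h₂⟩ _ ⟨A, hA, B, hB, rfl⟩
    have hA' : opTensor A 1 * X = X * opTensor A 1 := h₁ _ ⟨A, hA, rfl⟩
    have hB' : opTensor 1 B * X = X * opTensor 1 B := h₂ _ ⟨B, hB, rfl⟩
    rw [opTensor_eq_mul, mul_assoc, hB', ← mul_assoc, hA', mul_assoc]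

/-- An operator commuting with all `1 ⊗ B` commutes with `1 ⊗ u`, and multiplication by `1 ⊗ u`
exchanges `A ⊗ u` and `A ⊗ 1`. It serves to remove the parity once one factor is irreducible. -/
theorem centralizer_opTensor_involution_right (u : K →L[ℂ] K) (hu : u * u = 1)
    (S : Set (H →L[ℂ] H)) :
    Set.centralizer ((fun A => opTensor A u) '' S) ∩
        Set.centralizer ((fun B => opTensor 1 B) '' (Set.univ : Set (K →L[ℂ] K))) =
      Set.centralizer ((fun A => opTensor A 1) '' S) ∩
        Set.centralizer ((fun B => opTensor 1 B) '' (Set.univ : Set (K →L[ℂ] K))) := by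
  ext X
  refine and_congr_left fun h => ?_
  have hX : opTensor 1 u * X = X * opTensor 1 u := h _ ⟨u, trivial, rfl⟩
  constructor
  · rintro hS _ ⟨A, hA, rfl⟩
    have hA' : opTensor A u * X = X * opTensor A u := hS _ ⟨A, hA, rfl⟩
    have : (opTensor A 1 : HTensor H K →L[ℂ] _) = opTensor A u * opTensor 1 u := by
      rw [opTensor_mul, mul_one, hu]
    beta_reduce
    rw [this, mul_assoc, hX, ← mul_assoc, hA', mul_assoc]
  · rintro hS _ ⟨A, hA, rfl⟩
    have hA' : opTensor A 1 * X = X * opTensor A 1 := hS _ ⟨A, hA, rfl⟩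
    beta_reduce
    rw [opTensor_eq_mul, mul_assoc, hX, ← mul_assoc, hA', mul_assoc]

theorem centralizer_opTensor_involution_left (u : H →L[ℂ] H) (hu : u * u = 1)
    (S : Set (K →L[ℂ] K)) :
    Set.centralizer ((fun A => opTensor A 1) '' (Set.univ : Set (H →L[ℂ] H))) ∩
        Set.centralizer ((fun B => opTensor u B) '' S) =
      Set.centralizer ((fun A => opTensor A 1) '' (Set.univ : Set (H →L[ℂ] H))) ∩
        Set.centralizer ((fun B => opTensor 1 B) '' S) := by
  ext X
  refine and_congr_right fun h => ?_
  have hX : opTensor u 1 * X = X * opTensor u 1 := h _ ⟨u, trivial, rfl⟩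
  constructor
  · rintro hS _ ⟨A, hA, rfl⟩
    have hA' : opTensor u A * X = X * opTensor u A := hS _ ⟨A, hA, rfl⟩
    have : (opTensor 1 A : HTensor H K →L[ℂ] _) = opTensor u A * opTensor u 1 := by
      rw [opTensor_mul, mul_one, hu]
    beta_reduce
    rw [this, mul_assoc, hX, ← mul_assoc, hA', mul_assoc]
  · rintro hS _ ⟨A, hA, rfl⟩
    have hA' : opTensor 1 A * X = X * opTensor 1 A := hS _ ⟨A, hA, rfl⟩
    beta_reduce
    rw [opTensor_eq_mul', mul_assoc, hX, ← mul_assoc, hA', mul_assoc]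

theorem image_centralizer_inter {R S : Type*} [Mul R] [Mul S] (e : R ≃* S) (A B : Set R) :
    e '' Set.centralizer (Set.centralizer A ∩ Set.centralizer B) =
      Set.centralizer (Set.centralizer (e '' A) ∩ Set.centralizer (e '' B)) := by
  rw [← Set.centralizer_union, image_centralizer, image_centralizer, Set.image_union,
    Set.centralizer_union]

theorem conj_image_involutionConj [CompleteSpace H] [CompleteSpace K] (e : H ≃ₗᵢ[ℂ] K)
    {D : H →L[ℂ] H} {L : K →L[ℂ] K} (hD : D * D = 1) (hL : L * L = 1)
    (h : e.conjStarAlgEquiv D = L) (S : Set (H →L[ℂ] H)) :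
    involutionConj L hL '' (e.conjStarAlgEquiv '' S) =
      e.conjStarAlgEquiv '' (involutionConj D hD '' S) := by
  rw [Set.image_image, Set.image_image]
  refine Set.image_congr fun A _ => ?_
  change L * e.conjStarAlgEquiv A * L = e.conjStarAlgEquiv (D * A * D)
  rw [conj_mul, conj_mul, h]

end General

variable {W₁ W₂ : Type*} [NormedAddCommGroup W₁] [InnerProductSpace ℂ W₁]
  [NormedAddCommGroup W₂] [InnerProductSpace ℂ W₂]

theorem fieldAlgebra_realSum (V₁ : Submodule ℝ W₁) (V₂ : Submodule ℝ W₂) :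
    fieldAlgebra (realSum V₁ V₂) = (expLaw W₁ W₂).conjStarAlgEquiv '' Set.centralizer
      (Set.centralizer ((fun A => opTensor A 1) '' (field '' (V₁ : Set W₁))) ∩
        Set.centralizer ((fun B => opTensor (parity W₁) B) '' (field '' (V₂ : Set W₂)))) := by
  have h₁ : (0 : HTensor (Fock W₁) (Fock W₂) →L[ℂ] _) ∈
      (fun A => opTensor A 1) '' (field '' (V₁ : Set W₁)) :=
    ⟨0, ⟨0, V₁.zero_mem, field_zero⟩, zero_opTensor _⟩
  have h₂ : (0 : HTensor (Fock W₁) (Fock W₂) →L[ℂ] _) ∈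
      (fun B => opTensor (parity W₁) B) '' (field '' (V₂ : Set W₂)) :=
    ⟨0, ⟨0, V₂.zero_mem, field_zero⟩, opTensor_zero _⟩
  rw [← centralizer_add h₁ h₂, conj_image_centralizer, conj_image_centralizer, fieldAlgebra]
  congr 2
  apply Set.Subset.antisymm
  · rintro _ ⟨w, hw, rfl⟩
    exact ⟨_, ⟨_, ⟨_, ⟨w.fst, hw.1, rfl⟩, rfl⟩, _, ⟨_, ⟨w.snd, hw.2, rfl⟩, rfl⟩, rfl⟩,
      conj_expLaw_field w⟩
  · rintro _ ⟨_, ⟨_, ⟨_, ⟨v₁, hv₁, rfl⟩, rfl⟩, _, ⟨_, ⟨v₂, hv₂, rfl⟩, rfl⟩, rfl⟩, rfl⟩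
    exact ⟨WithLp.toLp 2 (v₁, v₂), ⟨hv₁, hv₂⟩,
      (conj_expLaw_field (WithLp.toLp 2 (v₁, v₂))).symm⟩

theorem twist_mul_Lam_mul_self : (twist W₁ W₂ * opTensor (Lam W₁) (Lam W₂)) *
    (twist W₁ W₂ * opTensor (Lam W₁) (Lam W₂)) = 1 := by
  rw [twist_mul_Lam, mul_assoc, ← mul_assoc (twist W₁ W₂), twist_mul_Lam, mul_assoc,
    twist_mul_self, mul_one, opTensor_mul, Lam_mul_self, Lam_mul_self, opTensor_one]

/-- `Λ` commutes with the parity, so conjugation by it keeps fields odd; this is what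
`twist_conj_left` needs. -/
theorem parity_mul_Lam_conj_field {Z : Type*} [NormedAddCommGroup Z] [InnerProductSpace ℂ Z]
    (w : Z) : parity Z * (Lam Z * field w * Lam Z) = -(Lam Z * field w * Lam Z * parity Z) := by
  rw [mul_assoc _ (Lam Z) (parity Z), ← parity_mul_Lam, ← mul_assoc, ← mul_assoc,
    parity_mul_Lam, mul_assoc (Lam Z) (parity Z), parity_mul_field]
  simp only [mul_neg, neg_mul, mul_assoc, parity_mul_Lam]

theorem twist_Lam_conj_left (v : W₁) :
    (twist W₁ W₂ * opTensor (Lam W₁) (Lam W₂)) * opTensor (field v) 1 *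
      (twist W₁ W₂ * opTensor (Lam W₁) (Lam W₂)) =
    opTensor (Lam W₁ * field v * Lam W₁) (parity W₂) := by
  rw [← twist_conj_left (parity_mul_Lam_conj_field v)]
  have : opTensor (Lam W₁) (Lam W₂) * opTensor (field v) 1 * opTensor (Lam W₁) (Lam W₂) =
      opTensor (Lam W₁ * field v * Lam W₁) 1 := by
    rw [opTensor_mul, opTensor_mul, mul_one, Lam_mul_self]
  rw [← this]
  -- Only the right-hand factor is reordered, so that `Λ₁ ⊗ Λ₂` stands next to the field on both
  -- sides and the twist stands outside.
  conv_lhs =>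
    arg 2
    rw [twist_mul_Lam]
  simp only [mul_assoc]

theorem twist_Lam_conj_right (v : W₂) :
    (twist W₁ W₂ * opTensor (Lam W₁) (Lam W₂)) * opTensor (parity W₁) (field v) *
      (twist W₁ W₂ * opTensor (Lam W₁) (Lam W₂)) =
    opTensor 1 (Lam W₂ * field v * Lam W₂) := by
  rw [← twist_conj_right (parity_mul_field v)]
  have : opTensor (Lam W₁) (Lam W₂) * opTensor 1 (field v) * opTensor (Lam W₁) (Lam W₂) =
      opTensor 1 (Lam W₂ * field v * Lam W₂) := by
    rw [opTensor_mul, opTensor_mul, mul_one, Lam_mul_self]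
  rw [← this, twist_mul_Lam]
  calc _ = opTensor (Lam W₁) (Lam W₂) * (twist W₁ W₂ * twist W₁ W₂) * opTensor 1 (field v) *
        (twist W₁ W₂ * (opTensor (Lam W₁) (Lam W₂) * twist W₁ W₂)) := by simp only [mul_assoc]
    _ = _ := by
      rw [← twist_mul_Lam, ← mul_assoc (twist W₁ W₂) (twist W₁ W₂), twist_mul_self, mul_one,
        one_mul]

theorem Lam_conj_fieldAlgebra_realSum (V₁ : Submodule ℝ W₁) (V₂ : Submodule ℝ W₂) :
    (fun A => Lam (WithLp 2 (W₁ × W₂)) * A * Lam (WithLp 2 (W₁ × W₂))) ''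
        fieldAlgebra (realSum V₁ V₂) =
      (expLaw W₁ W₂).conjStarAlgEquiv '' Set.centralizer
        (Set.centralizer ((fun A => opTensor A (parity W₂)) ''
            ((fun A => Lam W₁ * A * Lam W₁) '' (field '' (V₁ : Set W₁)))) ∩
          Set.centralizer ((fun B => opTensor 1 B) ''
            ((fun B => Lam W₂ * B * Lam W₂) '' (field '' (V₂ : Set W₂))))) := by
  rw [fieldAlgebra_realSum]
  refine (conj_image_involutionConj _ twist_mul_Lam_mul_self Lam_mul_self
    conj_expLaw_Lam _).trans ?_
  rw [image_centralizer_inter]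
  simp only [Set.image_image]
  congr 4 <;> refine congrArg _ (Set.image_congr fun v _ => ?_)
  · exact twist_Lam_conj_left v
  · exact twist_Lam_conj_right v

theorem Lam_conj_fieldAlgebra {Z : Type*} [NormedAddCommGroup Z] [InnerProductSpace ℂ Z]
    (V : Submodule ℝ Z) :
    (fun A => Lam Z * A * Lam Z) '' fieldAlgebra V =
      Set.centralizer (Set.centralizer ((fun A => Lam Z * A * Lam Z) '' (field '' (V : Set Z)))) := by
  change involutionConj (Lam Z) Lam_mul_self '' Set.centralizer (Set.centralizer _) = _
  rw [image_centralizer, image_centralizer]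
  rfl

theorem one_mem_fieldAlgebra {Z : Type*} [NormedAddCommGroup Z] [InnerProductSpace ℂ Z]
    (V : Submodule ℝ Z) : 1 ∈ fieldAlgebra V := Set.one_mem_centralizer

theorem centralizer_left_fieldAlgebra (V₁ : Submodule ℝ W₁) :
    Set.centralizer ((fun A => (opTensor A 1 : HTensor (Fock W₁) (Fock W₂) →L[ℂ] _)) ''
        fieldAlgebra V₁) =
      Set.centralizer ((fun A => opTensor A 1) '' (field '' (V₁ : Set W₁))) :=
  amplification_left.centralizer_image_bicommutant _

theorem centralizer_right_fieldAlgebra (V₂ : Submodule ℝ W₂) :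
    Set.centralizer ((fun B => (opTensor 1 B : HTensor (Fock W₁) (Fock W₂) →L[ℂ] _)) ''
        fieldAlgebra V₂) =
      Set.centralizer ((fun B => opTensor 1 B) '' (field '' (V₂ : Set W₂))) :=
  amplification_right.centralizer_image_bicommutant _

/-- The formula of `twist_conj_right` holds for odd operators only, not for all of `M(V₂)`.
Conjugation by the twist is therefore pulled out of the commutant, the algebra is replaced by its
generating fields, and the conjugation is put back. -/
theorem centralizer_twist_conj (V₂ : Submodule ℝ W₂) :
    Set.centralizer ((fun B => twist W₁ W₂ * opTensor 1 B * twist W₁ W₂) '' fieldAlgebra V₂) =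
      Set.centralizer ((fun B => opTensor (parity W₁) B) '' (field '' (V₂ : Set W₂))) := by
  have h : ∀ S : Set (Fock W₂ →L[ℂ] Fock W₂),
      Set.centralizer ((fun B => twist W₁ W₂ * opTensor 1 B * twist W₁ W₂) '' S) =
        involutionConj (twist W₁ W₂) twist_mul_self ''
          Set.centralizer ((fun B => (opTensor 1 B : HTensor (Fock W₁) (Fock W₂) →L[ℂ] _)) '' S) :=
      fun S => by
    rw [image_centralizer, Set.image_image]
    rfl
  rw [h, centralizer_right_fieldAlgebra, ← h, Set.image_image, Set.image_image]
  simp only [twist_conj_right (parity_mul_field _)]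

theorem fieldAlgebra_sum (V₁ : Submodule ℝ W₁) (V₂ : Submodule ℝ W₂) :
    fieldAlgebra (realSum V₁ V₂) =
      (expLaw W₁ W₂).conjStarAlgEquiv '' Set.centralizer (Set.centralizer
        ((fun A => opTensor A 1) '' fieldAlgebra V₁ +
          (fun B => twist W₁ W₂ * opTensor 1 B * twist W₁ W₂) '' fieldAlgebra V₂)) := by
  have h₁ : (0 : HTensor (Fock W₁) (Fock W₂) →L[ℂ] _) ∈
      (fun A => opTensor A 1) '' fieldAlgebra V₁ :=
    ⟨0, Set.zero_mem_centralizer, zero_opTensor _⟩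
  have h₂ : (0 : HTensor (Fock W₁) (Fock W₂) →L[ℂ] _) ∈
      (fun B => twist W₁ W₂ * opTensor 1 B * twist W₁ W₂) '' fieldAlgebra V₂ :=
    ⟨0, Set.zero_mem_centralizer, by
      beta_reduce
      rw [opTensor_zero, mul_zero, zero_mul]⟩
  rw [fieldAlgebra_realSum, centralizer_add h₁ h₂, centralizer_twist_conj,
    centralizer_left_fieldAlgebra]

theorem fieldAlgebra_sum_bot (V₁ : Submodule ℝ W₁) :
    fieldAlgebra (realSum V₁ (⊥ : Submodule ℝ W₂)) =
      (expLaw W₁ W₂).conjStarAlgEquiv '' ((fun A => opTensor A 1) '' fieldAlgebra V₁) := by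
  have h : Set.centralizer ((fun B => (opTensor (parity W₁) B :
      HTensor (Fock W₁) (Fock W₂) →L[ℂ] _)) '' (field '' ((⊥ : Submodule ℝ W₂) : Set W₂))) =
      Set.univ := centralizer_eq_univ_of_forall_eq_zero <| by
    rintro _ ⟨_, ⟨v, hv, rfl⟩, rfl⟩
    rw [(Submodule.mem_bot ℝ).1 hv, field_zero]
    exact opTensor_zero _
  rw [fieldAlgebra_realSum, h, Set.inter_univ, amplification_left.bicommutant_image, fieldAlgebra]

/-- Irreducibility replaces the fields of `W₁` by all bounded operators, among them `(-1)^N₁`, which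
then drops out of the second family. -/
theorem fieldAlgebra_top_sum (V₂ : Submodule ℝ W₂) :
    fieldAlgebra (realSum (⊤ : Submodule ℝ W₁) V₂) =
      (expLaw W₁ W₂).conjStarAlgEquiv '' algTensor Set.univ (fieldAlgebra V₂) := by
  rw [fieldAlgebra_realSum, algTensor, centralizer_image2_opTensor (Set.mem_univ 1)
    (one_mem_fieldAlgebra V₂), ← centralizer_left_fieldAlgebra, fieldAlgebra_top,
    centralizer_opTensor_involution_left _ parity_mul_self, centralizer_right_fieldAlgebra]

theorem Lam_conj_fieldAlgebra_sum_top (V₁ : Submodule ℝ W₁) :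
    (fun A => Lam (WithLp 2 (W₁ × W₂)) * A * Lam (WithLp 2 (W₁ × W₂))) ''
        fieldAlgebra (realSum V₁ (⊤ : Submodule ℝ W₂)) =
      (expLaw W₁ W₂).conjStarAlgEquiv ''
        algTensor ((fun A => Lam W₁ * A * Lam W₁) '' fieldAlgebra V₁) Set.univ := by
  have hΛ : (fun B => Lam W₂ * B * Lam W₂) '' Set.univ = Set.univ :=
    Set.image_univ_of_surjective (involutionConj (Lam W₂) Lam_mul_self).surjective
  rw [Lam_conj_fieldAlgebra_realSum, algTensor, Lam_conj_fieldAlgebra,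
    centralizer_image2_opTensor Set.one_mem_centralizer (Set.mem_univ 1),
    amplification_left.centralizer_image_bicommutant,
    -- Used backwards, this enlarges the conjugated fields of `W₂` to their bicommutant `Λ₂ M(W₂)
    -- Λ₂`, which is all of `B(Γ_a(W₂))` and so contains the parity to be removed.
    ← amplification_right.centralizer_image_bicommutant ((fun B => Lam W₂ * B * Lam W₂) '' _),
    ← Lam_conj_fieldAlgebra, fieldAlgebra_top, hΛ,
    centralizer_opTensor_involution_right _ parity_mul_self]

theorem Lam_conj_fieldAlgebra_bot_sum (V₂ : Submodule ℝ W₂) :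
    (fun A => Lam (WithLp 2 (W₁ × W₂)) * A * Lam (WithLp 2 (W₁ × W₂))) ''
        fieldAlgebra (realSum (⊥ : Submodule ℝ W₁) V₂) =
      (expLaw W₁ W₂).conjStarAlgEquiv ''
        ((fun B => opTensor 1 (Lam W₂ * B * Lam W₂)) '' fieldAlgebra V₂) := by
  have h : Set.centralizer ((fun A => (opTensor A (parity W₂) :
      HTensor (Fock W₁) (Fock W₂) →L[ℂ] _)) '' ((fun A => Lam W₁ * A * Lam W₁) ''
        (field '' ((⊥ : Submodule ℝ W₁) : Set W₁)))) = Set.univ :=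
    centralizer_eq_univ_of_forall_eq_zero <| by
      rintro _ ⟨_, ⟨_, ⟨v, hv, rfl⟩, rfl⟩, rfl⟩
      rw [(Submodule.mem_bot ℝ).1 hv, field_zero]
      beta_reduce
      rw [mul_zero, zero_mul]
      exact zero_opTensor _
  rw [Lam_conj_fieldAlgebra_realSum, h, Set.univ_inter, amplification_right.bicommutant_image,
    ← Lam_conj_fieldAlgebra, Set.image_image (fun B => opTensor 1 B)]

end Bicommutants

end FermiFock

theorem mainTheorem11 {W₁ W₂ : Type*}
    [NormedAddCommGroup W₁] [InnerProductSpace ℂ W₁] [CompleteSpace W₁]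
    [NormedAddCommGroup W₂] [InnerProductSpace ℂ W₂] [CompleteSpace W₂]
    (V₁ : Submodule ℝ W₁) (V₂ : Submodule ℝ W₂)
    (hV₁ : IsClosed (V₁ : Set W₁)) (hV₂ : IsClosed (V₂ : Set W₂)) :
    fieldAlgebra (realSum V₁ V₂) =
      (expLaw W₁ W₂).conjStarAlgEquiv '' Set.centralizer (Set.centralizer
        ((fun A => opTensor A 1) '' fieldAlgebra V₁ +
          (fun B => twist W₁ W₂ * opTensor 1 B * twist W₁ W₂) '' fieldAlgebra V₂)) ∧
    fieldAlgebra (realSum V₁ (⊥ : Submodule ℝ W₂)) =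
      (expLaw W₁ W₂).conjStarAlgEquiv '' ((fun A => opTensor A 1) '' fieldAlgebra V₁) ∧
    fieldAlgebra (realSum (⊤ : Submodule ℝ W₁) V₂) =
      (expLaw W₁ W₂).conjStarAlgEquiv '' algTensor Set.univ (fieldAlgebra V₂) ∧
    (fun A => Lam (WithLp 2 (W₁ × W₂)) * A * Lam (WithLp 2 (W₁ × W₂))) ''
        fieldAlgebra (realSum V₁ (⊤ : Submodule ℝ W₂)) =
      (expLaw W₁ W₂).conjStarAlgEquiv ''
        algTensor ((fun A => Lam W₁ * A * Lam W₁) '' fieldAlgebra V₁) Set.univ ∧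
    (fun A => Lam (WithLp 2 (W₁ × W₂)) * A * Lam (WithLp 2 (W₁ × W₂))) ''
        fieldAlgebra (realSum (⊥ : Submodule ℝ W₁) V₂) =
      (expLaw W₁ W₂).conjStarAlgEquiv ''
        ((fun B => opTensor 1 (Lam W₂ * B * Lam W₂)) '' fieldAlgebra V₂) := by
  exact ⟨fieldAlgebra_sum V₁ V₂, fieldAlgebra_sum_bot V₁, fieldAlgebra_top_sum V₂,
    Lam_conj_fieldAlgebra_sum_top V₁, Lam_conj_fieldAlgebra_bot_sum V₂⟩
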